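/- **Setting.** Let $d,p\ge 1$. For $\mathbf r\in\mathbb R^d$ and $A\subseteq\mathbb R^d$ write $\mathbf rA=\{(r_1a_1,\dots,r_da_d): a\in A\}$. Let $D_n=C_n\cap\mathbb Z^d$, where each $C_n=\bigcup_{i=1}^pC_{n,i}$ is a union of $p$ convex bodies (compact convex subsets of $\mathbb R^d$ with non-empty interior), $|C_n|\to\infty$, and there are vectors $\mathbf c_n\in(0,\infty)^d$ and a constant $0<c<\infty$ with (i) $c_{n,\ell}\to\infty$ for every $\ell$, (ii) $\prod_{\ell}c_{n,\ell}\sim|C_n|$, (iii) $C_n\subseteq\mathbf c_n[-c,c]^d$ for all $n$. Here $|\cdot|$ is Lebesgue measure for subsets of $\mathbb R^d$ and the number of points for subsets of $\mathbb Z^d$. Let $(\xi_v)_{v\in\mathbb Z^d}$ be a (strictly) stationary real random field, put $M(A)=\max_{v\in A}\xi_v$ with $M(\emptyset)=-\infty$, and let $(x_n)$ be a real sequence and $(k_n)$ a sequence of positive integers. Put $t_n^\ell=\lfloor c_{n,\ell}/k_n^{1/d}\rfloor$ and $I_z^n=\prod_{\ell=1}^d[z_\ell t_n^\ell,(z_\ell+1)t_n^\ell)$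 for $z\in\mathbb Z^d$. Let $K_n=\mathbb Z^d\cap\mathbf c_n[-b,b]^d$, where $0<b<\infty$ is a constant such that, for all $n$, $K_n$ contains the lattice points of every box $I_z^n$ that meets $C_n$. *Mixing condition* $\mathcal D(x_n;K_n)$. There are vectors $\boldsymbol\gamma_n\in(0,\infty)^d$, non-decreasing in $n$ coordinate-wise, with $\gamma_{n,\ell}/c_{n,\ell}\to0$ for every $\ell$, and numbers $\alpha_n\to0$, such that for all $n$ and all $A,B\subseteq K_n$, at least one of which is a box, with $B\cap(A\oplus\boldsymbol\gamma_nB(1))=\emptyset$ (where $B(1)$ is the closed Euclidean unit ball and $\oplus$ the Minkowski sum), $$\bigl|P(M(A\cup B)\le x_n)-P(M(A)\le x_n)\,P(M(B)\le x_n)\bigr|\le\alpha_n .$$ Let $\preceq$ be a translation invariant total order on $\mathbb Z^d$, and put $A_0^{(m)}=\{v\in[-m,m]^d\cap\mathbb Z^d:0\prec v\}$ and $A_0^{n,k_n}=\{v\in\mathbb Z^d:|v_\ell|\le t_n^\ell\text{ for all }\ell,\ 0\prec v\}$. *Anti-clustering condition* $\mathcal D^{(m)}(x_n;k_n)$: $$|D_n|\,P\bigl(M(A_0^{(m)})\le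 x_n<\xi_0,\ M(A_0^{n,k_n}\setminus A_0^{(m)})>x_n\bigr)\to0 .$$ **Corollary 3.6.** Suppose that $\mathcal D(x_n;K_n)$ holds with $\boldsymbol\gamma_n$ and $\alpha_n$, that $k_n\to\infty$, $k_n\alpha_n\to0$ and $k_n^{1/d}\gamma_{n,\ell}/c_{n,\ell}\to0$ for every $\ell$, that $\mathcal D^{(m)}(x_n;k_n)$ holds for some integer $m\ge0$, and that for this $m$ and some $\theta\in(0,1]$ $$P\bigl(M(A_0^{(m)})\le x_n\mid\xi_0>x_n\bigr)\to\theta .$$ Then, for every $0\le\tau<\infty$, as $n\to\infty$, $$|D_n|\,P(\xi_0>x_n)\to\tau\quad\text{if and only if}\quad P\bigl(\max_{v\in D_n}\xi_v\le x_n\bigr)\to e^{-\theta\tau}.$$ -/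

import Mathlib

open Set Filter Topology MeasureTheory ProbabilityTheory
open scoped Pointwise

namespace SpatialExtremes

variable {d : ℕ} {Ω : Type*} [MeasurableSpace Ω]

/-! ### Geometry -/

/-- The inclusion of the lattice `ℤ^d` in `ℝ^d`. -/
def latticeEmb (v : Fin d → ℤ) : Fin d → ℝ := fun ℓ => (v ℓ : ℝ)

/-- The lattice points `A ∩ ℤ^d` of a set `A ⊆ ℝ^d`. -/
def latticePoints (A : Set (Fin d → ℝ)) : Set (Fin d → ℤ) := latticeEmb ⁻¹' A

/-- The coordinate-wise scaling `r A = {(r₁ a₁, …, r_d a_d) : a ∈ A}`. -/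
def coordScale (r : Fin d → ℝ) (A : Set (Fin d → ℝ)) : Set (Fin d → ℝ) :=
  (fun a ℓ => r ℓ * a ℓ) '' A

/-- The cube `[-b, b]^d`. -/
def cube (d : ℕ) (b : ℝ) : Set (Fin d → ℝ) := {u | ∀ ℓ, -b ≤ u ℓ ∧ u ℓ ≤ b}

/-- The closed unit ball `B(1)` of `ℝ^d` for the Euclidean norm
(the default norm on `Fin d → ℝ` is the supremum norm, so it is written out). -/
def euclideanUnitBall (d : ℕ) : Set (Fin d → ℝ) := {u | ∑ ℓ, u ℓ ^ 2 ≤ 1}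

/-- A convex body: a compact convex set with non-empty interior. -/
structure IsConvexBody (A : Set (Fin d → ℝ)) : Prop where
  isCompact : IsCompact A
  convex : Convex ℝ A
  interior_nonempty : (interior A).Nonempty

/-- The geometric assumption on the index sets `D n ⊆ ℤ^d`: here `Cpart n i`, `i < p`, are the
convex bodies whose union is `C n`, and `c n` are the scaling vectors. -/
structure GeometricAssumption (D : ℕ → Set (Fin d → ℤ)) {p : ℕ}
    (Cpart : ℕ → Fin p → Set (Fin d → ℝ)) (C : ℕ → Set (Fin d → ℝ))
    (c : ℕ → Fin d → ℝ) : Prop where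
  convexBody : ∀ n i, IsConvexBody (Cpart n i)
  eq_union : ∀ n, C n = ⋃ i, Cpart n i
  eq_latticePoints : ∀ n, D n = latticePoints (C n)
  volume_tendsto : Tendsto (fun n => volume.real (C n)) atTop atTop
  scale_pos : ∀ n ℓ, 0 < c n ℓ
  scale_tendsto : ∀ ℓ, Tendsto (fun n => c n ℓ) atTop atTop
  scale_equivalent :
    Asymptotics.IsEquivalent atTop (fun n => ∏ ℓ, c n ℓ) (fun n => volume.real (C n))
  subset_box : ∃ b : ℝ, 0 < b ∧ ∀ n, C n ⊆ coordScale (c n) (cube d b)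

/-- The integer side lengths `t^ℓ = ⌊c_ℓ / k^{1/d}⌋`. -/
noncomputable def blockSide (c : Fin d → ℝ) (k : ℕ) (ℓ : Fin d) : ℤ :=
  ⌊c ℓ / (k : ℝ) ^ ((1 : ℝ) / d)⌋

/-- The box `I_z = ∏_ℓ [z_ℓ t^ℓ, (z_ℓ + 1) t^ℓ)`. -/
def block (t : Fin d → ℤ) (z : Fin d → ℤ) : Set (Fin d → ℝ) :=
  {u | ∀ ℓ, (z ℓ : ℝ) * t ℓ ≤ u ℓ ∧ u ℓ < ((z ℓ : ℝ) + 1) * t ℓ}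

/-- The outer approximation `D⁺`: the union of the lattice points of all boxes `I_z` that meet
`C`. -/
def outerApprox (C : Set (Fin d → ℝ)) (t : Fin d → ℤ) : Set (Fin d → ℤ) :=
  ⋃ z ∈ {z : Fin d → ℤ | (block t z ∩ C).Nonempty}, latticePoints (block t z)

/-- The surrounding lattice box `K = ℤ^d ∩ c [-b, b]^d`. -/
def surroundingBox (c : Fin d → ℝ) (b : ℝ) : Set (Fin d → ℤ) :=
  latticePoints (coordScale c (cube d b))

/-- `B ⊆ (A ⊕ γ B(1))ᶜ`. -/
def Separated (γ : Fin d → ℝ) (A B : Set (Fin d → ℤ)) : Prop :=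
  latticeEmb '' B ⊆ (latticeEmb '' A + coordScale γ (euclideanUnitBall d))ᶜ

/-- A (discrete) box in `ℤ^d`. -/
def IsBox (A : Set (Fin d → ℤ)) : Prop := ∃ a b : Fin d → ℤ, A = Set.Icc a b

/-- A translation invariant total order on `ℤ^d`, given by its strict part. -/
structure IsTranslationInvariantOrder (prec : (Fin d → ℤ) → (Fin d → ℤ) → Prop) : Prop where
  strictTotal : IsStrictTotalOrder (Fin d → ℤ) prec
  add_right : ∀ u v w, prec u v → prec (u + w) (v + w)

/-- The points `v ≻ 0` of the lattice box `∏_ℓ [-s_ℓ, s_ℓ]`. -/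
def positiveNeighbors (prec : (Fin d → ℤ) → (Fin d → ℤ) → Prop) (s : Fin d → ℤ) :
    Set (Fin d → ℤ) :=
  {v | (∀ ℓ, -s ℓ ≤ v ℓ ∧ v ℓ ≤ s ℓ) ∧ prec 0 v}

/-! ### The random field -/

/-- Strict stationarity: the law of the field is invariant under all translations of `ℤ^d`. -/
def IsStationary (μ : Measure Ω) (ξ : (Fin d → ℤ) → Ω → ℝ) : Prop :=
  ∀ h : Fin d → ℤ, μ.map (fun ω v => ξ (v + h) ω) = μ.map (fun ω v => ξ v ω)

/-- `M_ξ(A) = max_{v ∈ A} ξ_v` as an extended real number, with `M_ξ(∅) = -∞`. -/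
noncomputable def fieldMax (ξ : (Fin d → ℤ) → Ω → ℝ) (A : Set (Fin d → ℤ)) (ω : Ω) : EReal :=
  ⨆ v ∈ A, (ξ v ω : EReal)

/-- The mixing condition `𝒟(x_n; K_n)`, with separation vectors `γ n` and mixing constants
`α n`; the `c n` are the scaling vectors of the index sets. -/
structure MixingCondition (μ : Measure Ω) (ξ : (Fin d → ℤ) → Ω → ℝ) (x : ℕ → ℝ)
    (K : ℕ → Set (Fin d → ℤ)) (c γ : ℕ → Fin d → ℝ) (α : ℕ → ℝ) : Prop where
  sep_pos : ∀ n ℓ, 0 < γ n ℓ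
  sep_mono : Monotone γ
  sep_isLittleO : ∀ ℓ, Tendsto (fun n => γ n ℓ / c n ℓ) atTop (𝓝 0)
  mixing : ∀ n, ∀ A B : Set (Fin d → ℤ), A ⊆ K n → B ⊆ K n → Separated (γ n) A B →
    (IsBox A ∨ IsBox B) →
    |μ.real {ω | fieldMax ξ (A ∪ B) ω ≤ x n} -
      μ.real {ω | fieldMax ξ A ω ≤ x n} * μ.real {ω | fieldMax ξ B ω ≤ x n}| ≤ α n
  coeff_tendsto : Tendsto α atTop (𝓝 0)

/-- The anti-clustering condition `𝒟^{(m)}(x_n; k_n)`: with `A₀^{(m)}` the positive neighbours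
in `[-m, m]^d` and `A₀^{n,k_n}` those in the box with half side lengths `t_{n,k_n}`,
`|D_n| P(M(A₀^{(m)}) ≤ x_n < ξ_0, M(A₀^{n,k_n} \ A₀^{(m)}) > x_n) → 0`. -/
def AntiClustering (μ : Measure Ω) (ξ : (Fin d → ℤ) → Ω → ℝ) (D : ℕ → Set (Fin d → ℤ))
    (c : ℕ → Fin d → ℝ) (prec : (Fin d → ℤ) → (Fin d → ℤ) → Prop) (m : ℕ) (x : ℕ → ℝ)
    (k : ℕ → ℕ) : Prop :=
  Tendsto (fun n => ((D n).ncard : ℝ) *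
      μ.real {ω | fieldMax ξ (positiveNeighbors prec (fun _ => (m : ℤ))) ω ≤ x n ∧
        x n < ξ 0 ω ∧
        x n < fieldMax ξ (positiveNeighbors prec (blockSide (c n) (k n)) \
          positiveNeighbors prec (fun _ => (m : ℤ))) ω})
    atTop (𝓝 0)

end SpatialExtremes

namespace SpatialExtremes

/-! ### Exceedance probabilities, last exceedances and mixing over separated boxes. -/

section Probability

variable {d : ℕ} {Ω : Type*} {ξ : (Fin d → ℤ) → Ω → ℝ}

/-! The proof is a blocking argument. About `k n` boxes of the grid cover the index set. Cutting a
margin of width at least `γ n` off each box makes the remaining cores separated, so mixing turns the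
probability of no exceedance into a power `q ^ N` with `N ∼ k n`, at a cost of order `k n * α n`.
Here `q` is the probability of no exceedance in one core.

Inside a core, an exceedance occurs exactly when there is a last one in the order `prec`. Its
probability is therefore about the number of points times the probability that the origin exceeds
while its positive neighbours within distance `m` do not. Anti-clustering replaces neighbours in the
whole block by these close ones (`measureReal_fieldMax_subBlock_le`); in the other direction only
points near the faces of the core need correction (`le_measureReal_fieldMax_subBlock`). With `a =
|D| P(ξ₀ > x)`, this gives `q ≈ 1 - θ a / k` and hence `q ^ N ≈ exp (-θ a)`.

The geometric input is `exists_block_counts`: by convexity, boxes meeting the boundary are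
negligible among the `k n`, so inner boxes (for the upper bound) and outer boxes (for the lower
bound) give the same limit.

For the converse implication `a` is not known to be bounded. The upper bound on the probability
needs no such bound and itself yields one, after which the lower bound applies
(`tendsto_iff_tendsto_exp`). -/

theorem fieldMax_le_iff {A : Set (Fin d → ℤ)} {ω : Ω} {x : ℝ} :
    fieldMax ξ A ω ≤ x ↔ ∀ v ∈ A, ξ v ω ≤ x := by
  simp [fieldMax]

theorem lt_fieldMax_iff {A : Set (Fin d → ℤ)} {ω : Ω} {x : ℝ} :
    x < fieldMax ξ A ω ↔ ∃ v ∈ A, x < ξ v ω := by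
  rw [← not_le, fieldMax_le_iff]
  simp

theorem fieldMax_mono {A B : Set (Fin d → ℤ)} (h : A ⊆ B) (ω : Ω) :
    fieldMax ξ A ω ≤ fieldMax ξ B ω :=
  biSup_mono fun _ hv => h hv

variable [MeasurableSpace Ω] {μ : Measure Ω}

theorem measurableSet_forall_le (A : Set (Fin d → ℤ)) (x : ℝ) :
    MeasurableSet {f : (Fin d → ℤ) → ℝ | ∀ v ∈ A, f v ≤ x} := by
  have : {f : (Fin d → ℤ) → ℝ | ∀ v ∈ A, f v ≤ x} = ⋂ v ∈ A, {f | f v ≤ x} := by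
    ext; simp
  rw [this]
  exact MeasurableSet.biInter (Set.to_countable _)
    fun v _ => measurableSet_le (measurable_pi_apply v) measurable_const

theorem measurableSet_fieldMax_le (hmeas : ∀ v, Measurable (ξ v)) (A : Set (Fin d → ℤ)) (x : ℝ) :
    MeasurableSet {ω | fieldMax ξ A ω ≤ x} := by
  simp only [fieldMax_le_iff]
  exact (measurable_pi_iff.2 hmeas) (measurableSet_forall_le A x)

theorem measurableSet_exceed (hmeas : ∀ v, Measurable (ξ v)) (v : Fin d → ℤ) (x : ℝ) :
    MeasurableSet {ω | x < ξ v ω} :=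
  measurableSet_lt measurable_const (hmeas v)

theorem IsStationary.measureReal_eq (hstat : IsStationary μ ξ) (hmeas : ∀ v, Measurable (ξ v))
    (h : Fin d → ℤ) {S : Set ((Fin d → ℤ) → ℝ)} (hS : MeasurableSet S) :
    μ.real {ω | (fun v => ξ (v + h) ω) ∈ S} = μ.real {ω | (fun v => ξ v ω) ∈ S} := by
  have h1 : Measurable fun ω v => ξ (v + h) ω := measurable_pi_iff.2 fun v => hmeas (v + h)
  have h2 : Measurable fun ω v => ξ v ω := measurable_pi_iff.2 hmeas
  have := congrArg (fun ν => ν S) (hstat h)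
  simp only [Measure.map_apply h1 hS, Measure.map_apply h2 hS] at this
  exact congrArg ENNReal.toReal this

theorem IsStationary.measureReal_fieldMax_le (hstat : IsStationary μ ξ)
    (hmeas : ∀ v, Measurable (ξ v)) (h : Fin d → ℤ) {A B : Set (Fin d → ℤ)} (x : ℝ)
    (hAB : ∀ v, v ∈ A ↔ v + h ∈ B) :
    μ.real {ω | fieldMax ξ B ω ≤ x} = μ.real {ω | fieldMax ξ A ω ≤ x} := by
  simp only [fieldMax_le_iff]
  refine Eq.trans ?_ (hstat.measureReal_eq hmeas h (measurableSet_forall_le A x))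
  congr 1
  ext ω
  simp only [mem_ofPred_eq]
  refine ⟨fun H v hv => H _ ((hAB v).1 hv), fun H v hv => ?_⟩
  have := H (v - h) ((hAB _).2 (by simpa using hv))
  simpa using this

theorem IsStationary.measureReal_exceed (hstat : IsStationary μ ξ)
    (hmeas : ∀ v, Measurable (ξ v)) (v : Fin d → ℤ) (x : ℝ) :
    μ.real {ω | x < ξ v ω} = μ.real {ω | x < ξ 0 ω} := by
  have := hstat.measureReal_eq hmeas v (S := {f | x < f 0})
    (measurableSet_lt measurable_const (measurable_pi_apply 0))
  simpa using this

theorem IsStationary.measureReal_exceed_and (hstat : IsStationary μ ξ)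
    (hmeas : ∀ v, Measurable (ξ v)) (v : Fin d → ℤ) (S : Set (Fin d → ℤ)) (x : ℝ) :
    μ.real {ω | x < ξ v ω ∧ ∀ w ∈ S, ξ (w + v) ω ≤ x} =
      μ.real {ω | x < ξ 0 ω ∧ fieldMax ξ S ω ≤ x} := by
  have := hstat.measureReal_eq hmeas v (S := {f | x < f 0 ∧ ∀ w ∈ S, f w ≤ x})
    ((measurableSet_lt measurable_const (measurable_pi_apply 0)).inter
      (measurableSet_forall_le S x))
  simpa [fieldMax_le_iff] using this

theorem measureReal_lt_fieldMax [IsProbabilityMeasure μ] (hmeas : ∀ v, Measurable (ξ v))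
    (A : Set (Fin d → ℤ)) (x : ℝ) :
    μ.real {ω | x < fieldMax ξ A ω} = 1 - μ.real {ω | fieldMax ξ A ω ≤ x} := by
  rw [← probReal_compl_eq_one_sub (measurableSet_fieldMax_le hmeas A x)]
  congr 1
  ext ω
  simp

theorem measureReal_lt_fieldMax_le [IsProbabilityMeasure μ] (hstat : IsStationary μ ξ)
    (hmeas : ∀ v, Measurable (ξ v)) (A : Finset (Fin d → ℤ)) (x : ℝ) :
    μ.real {ω | x < fieldMax ξ A ω} ≤ A.card * μ.real {ω | x < ξ 0 ω} := by
  have : {ω | x < fieldMax ξ A ω} = ⋃ v ∈ A, {ω | x < ξ v ω} := by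
    ext ω; simp [lt_fieldMax_iff]
  rw [this]
  refine (measureReal_biUnion_finset_le _ _).trans ?_
  simp [hstat.measureReal_exceed hmeas]

/-- The events that `v` is the last exceedance are disjoint. -/
theorem card_mul_le_measureReal_lt_fieldMax [IsProbabilityMeasure μ] (hstat : IsStationary μ ξ)
    (hmeas : ∀ v, Measurable (ξ v)) {prec : (Fin d → ℤ) → (Fin d → ℤ) → Prop}
    (hprec : IsTranslationInvariantOrder prec) (J : Finset (Fin d → ℤ)) (S : Set (Fin d → ℤ))
    (hS : ∀ v ∈ J, ∀ w ∈ J, prec v w → w - v ∈ S) (x : ℝ) :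
    J.card * μ.real {ω | x < ξ 0 ω ∧ fieldMax ξ S ω ≤ x} ≤
      μ.real {ω | x < fieldMax ξ J ω} := by
  have hst := hprec.strictTotal
  let E : (Fin d → ℤ) → Set Ω := fun v => {ω | x < ξ v ω ∧ ∀ w ∈ S, ξ (w + v) ω ≤ x}
  have hmE : ∀ v, MeasurableSet (E v) := fun v => by
    have h : MeasurableSet {f : (Fin d → ℤ) → ℝ | x < f v ∧ ∀ w ∈ (fun w => w + v) '' S, f w ≤ x} :=
      (measurableSet_lt measurable_const (measurable_pi_apply v)).inter
        (measurableSet_forall_le ((fun w => w + v) '' S) x)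
    simp only [forall_mem_image] at h
    exact (measurable_pi_iff.2 hmeas) h
  have key : ∀ v ∈ J, ∀ w ∈ J, prec v w → Disjoint (E v) (E w) := by
    intro v hv w hw h
    rw [Set.disjoint_left]
    intro ω h1 h2
    have := h1.2 _ (hS v hv w hw h)
    rw [sub_add_cancel] at this
    exact absurd h2.1 (not_lt.2 this)
  have hd : PairwiseDisjoint (J : Set (Fin d → ℤ)) E := by
    intro v hv w hw hne
    rcases trichotomous_of prec v w with h | h | h
    · exact key v hv w hw h
    · exact absurd h hne
    · exact (key w hw v hv h).symm
  have hsum := measureReal_biUnion_finset (μ := μ) hd fun v _ => hmE v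
  have : ∑ v ∈ J, μ.real (E v) = J.card * μ.real {ω | x < ξ 0 ω ∧ fieldMax ξ S ω ≤ x} := by
    simp [E, hstat.measureReal_exceed_and hmeas]
  rw [← this, ← hsum]
  refine measureReal_mono ?_
  intro ω hω
  simp only [mem_iUnion] at hω
  obtain ⟨v, hv, h, -⟩ := hω
  exact lt_fieldMax_iff.2 ⟨v, hv, h⟩

/-- Union bound over the position `v` of the last exceedance in `J`. If `v` lies in `I`, then `v +
S` stays in `J` and comes after `v`, so it carries no exceedance. Positions in `J \ I` are charged
the full exceedance probability. -/
theorem measureReal_lt_fieldMax_le_card_mul [IsProbabilityMeasure μ] (hstat : IsStationary μ ξ)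
    (hmeas : ∀ v, Measurable (ξ v)) {prec : (Fin d → ℤ) → (Fin d → ℤ) → Prop}
    (hprec : IsTranslationInvariantOrder prec) {I J : Finset (Fin d → ℤ)} (hIJ : I ⊆ J)
    (S : Set (Fin d → ℤ)) (hS : ∀ w ∈ S, prec 0 w) (hI : ∀ v ∈ I, ∀ w ∈ S, w + v ∈ J) (x : ℝ) :
    μ.real {ω | x < fieldMax ξ J ω} ≤
      J.card * μ.real {ω | x < ξ 0 ω ∧ fieldMax ξ S ω ≤ x} +
        (J.card - I.card : ℝ) * μ.real {ω | x < ξ 0 ω} := by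
  have hst := hprec.strictTotal
  classical
  have hsub : {ω | x < fieldMax ξ J ω} ⊆
      (⋃ v ∈ J, {ω | x < ξ v ω ∧ ∀ w ∈ S, ξ (w + v) ω ≤ x}) ∪
        {ω | x < fieldMax ξ (J \ I : Finset (Fin d → ℤ)) ω} := by
    intro ω hω
    let F := J.filter fun v => x < ξ v ω
    have hF : F.Nonempty := by
      obtain ⟨v, hv, h⟩ := lt_fieldMax_iff.1 hω
      exact ⟨v, by simpa [F] using ⟨hv, h⟩⟩
    obtain ⟨v, hvF, hv⟩ : ∃ v ∈ F, ∀ w ∈ F, ¬ prec v w := by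
      -- The last exceedance is the maximum of the finite set `F` in the linear order induced by
      -- `prec`.
      let _ := linearOrderOfSTO prec
      obtain ⟨v, hv, h⟩ := F.exists_max_image id hF
      exact ⟨v, hv, fun w hw => not_lt.2 (h w hw)⟩
    simp only [F, Finset.mem_filter] at hvF hv
    by_cases hvI : v ∈ I
    · left
      simp only [mem_iUnion]
      refine ⟨v, hvF.1, hvF.2, fun w hw => ?_⟩
      by_contra hlt
      refine hv (w + v) ⟨hI v hvI w hw, not_le.1 hlt⟩ ?_
      simpa using hprec.add_right 0 w v (hS w hw)
    · right
      exact lt_fieldMax_iff.2 ⟨v, by simp [hvF.1, hvI], hvF.2⟩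
  refine (measureReal_mono hsub).trans ((measureReal_union_le _ _).trans (add_le_add ?_ ?_))
  · refine (measureReal_biUnion_finset_le _ _).trans ?_
    simp [hstat.measureReal_exceed_and hmeas]
  · refine (measureReal_lt_fieldMax_le hstat hmeas _ x).trans ?_
    rw [Finset.cast_card_sdiff hIJ]

theorem separated_iff {γ : Fin d → ℝ} {A B : Set (Fin d → ℤ)} :
    Separated γ A B ↔ ∀ a ∈ A, ∀ b ∈ B, ∀ u ∈ euclideanUnitBall d,
      ¬ ∀ ℓ, (a ℓ : ℝ) + γ ℓ * u ℓ = b ℓ := by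
  constructor
  · intro h a ha b hb u hu he
    exact h (mem_image_of_mem _ hb) ⟨_, mem_image_of_mem _ ha, _, mem_image_of_mem _ hu, funext he⟩
  · rintro h _ ⟨b, hb, rfl⟩ ⟨_, ⟨a, ha, rfl⟩, _, ⟨u, hu, rfl⟩, he⟩
    exact h a ha b hb u hu fun ℓ => congrFun he ℓ

/-- The Euclidean unit ball lies in the cube `[-1, 1]^d`, so a large gap in a single coordinate
suffices. -/
theorem separated_of_exists_lt {γ : Fin d → ℝ} (hγ : ∀ ℓ, 0 ≤ γ ℓ) {A B : Set (Fin d → ℤ)}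
    (h : ∀ a ∈ A, ∀ b ∈ B, ∃ ℓ, γ ℓ < |(b ℓ : ℝ) - a ℓ|) : Separated γ A B := by
  rw [separated_iff]
  intro a ha b hb u hu he
  obtain ⟨ℓ, hℓ⟩ := h a ha b hb
  have hu1 : u ℓ ^ 2 ≤ 1 :=
    (Finset.single_le_sum (f := fun ℓ => u ℓ ^ 2) (fun i _ => sq_nonneg _)
      (Finset.mem_univ ℓ)).trans hu
  have hu2 : |u ℓ| ≤ 1 := (sq_le_one_iff_abs_le_one _).1 hu1
  rw [← he ℓ, add_sub_cancel_left, abs_mul, abs_of_nonneg (hγ ℓ)] at hℓ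
  nlinarith [hγ ℓ]

/-- Asymptotic independence over finitely many pairwise separated boxes. -/
theorem abs_measureReal_biUnion_sub_prod_le [IsProbabilityMeasure μ]
    {ι : Type*} (Z : Finset ι) (J : ι → Set (Fin d → ℤ)) {K : Set (Fin d → ℤ)} {x α : ℝ}
    {γ : Fin d → ℝ} (hγ : ∀ ℓ, 0 ≤ γ ℓ)
    (hmix : ∀ A B : Set (Fin d → ℤ), A ⊆ K → B ⊆ K → Separated γ A B → (IsBox A ∨ IsBox B) →
      |μ.real {ω | fieldMax ξ (A ∪ B) ω ≤ x} -
        μ.real {ω | fieldMax ξ A ω ≤ x} * μ.real {ω | fieldMax ξ B ω ≤ x}| ≤ α)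
    (hJ : ∀ z ∈ Z, IsBox (J z)) (hJK : ∀ z ∈ Z, J z ⊆ K)
    (hsep : ∀ z ∈ Z, ∀ z' ∈ Z, z ≠ z' → ∀ a ∈ J z, ∀ b ∈ J z', ∃ ℓ, γ ℓ < |(b ℓ : ℝ) - a ℓ|) :
    |μ.real {ω | fieldMax ξ (⋃ z ∈ Z, J z) ω ≤ x} -
      ∏ z ∈ Z, μ.real {ω | fieldMax ξ (J z) ω ≤ x}| ≤ Z.card * α := by
  classical
  induction Z using Finset.induction_on with
  | empty => simp [fieldMax]
  | insert z Z hz ih =>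
    have ih := ih (fun y hy => hJ y (Finset.mem_insert_of_mem hy))
      (fun y hy => hJK y (Finset.mem_insert_of_mem hy))
      (fun y hy y' hy' => hsep y (Finset.mem_insert_of_mem hy) y' (Finset.mem_insert_of_mem hy'))
    rw [Finset.set_biUnion_insert, Finset.prod_insert hz, Finset.card_insert_of_notMem hz]
    have h1 := hmix (J z) (⋃ y ∈ Z, J y) (hJK z (Finset.mem_insert_self _ _))
      (iUnion₂_subset fun y hy => hJK y (Finset.mem_insert_of_mem hy))
      (separated_of_exists_lt hγ fun a ha b hb => by
        simp only [mem_iUnion] at hb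
        obtain ⟨y, hy, hb⟩ := hb
        exact hsep z (Finset.mem_insert_self _ _) y (Finset.mem_insert_of_mem hy)
          (fun h => hz (h ▸ hy)) a ha b hb)
      (Or.inl (hJ z (Finset.mem_insert_self _ _)))
    set q := μ.real {ω | fieldMax ξ (J z) ω ≤ x}
    set r := μ.real {ω | fieldMax ξ (⋃ y ∈ Z, J y) ω ≤ x}
    set π := ∏ y ∈ Z, μ.real {ω | fieldMax ξ (J y) ω ≤ x}
    have h2 : |q * r - q * π| ≤ Z.card * α := by
      rw [← mul_sub, abs_mul, abs_of_nonneg measureReal_nonneg]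
      exact (mul_le_of_le_one_left (abs_nonneg _) measureReal_le_one).trans ih
    push_cast
    linarith [abs_sub_le (μ.real {ω | fieldMax ξ (J z ∪ ⋃ y ∈ Z, J y) ω ≤ x}) (q * r) (q * π)]

end Probability

/-! ### Counting grid boxes inside, outside and across a union of convex sets. -/

section Geometry

variable {d : ℕ}

/-- The vector of `{-1, 1}^d` with prescribed signs. -/
def signVector (ε : Fin d → Bool) : Fin d → ℤ := fun ℓ => if ε ℓ then 1 else -1

/-- A hyperplane separates `A` from a point `y` of the box outside `A`. Let `f` be the functional,
larger at `y` than on `A`. Moving the box by whole steps along the signs of the coefficients of `f`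
puts every point of it at a value at least `f y`, out of reach of `A`. -/
theorem exists_signVector_block_disjoint {A : Set (Fin d → ℝ)} (hA : Convex ℝ A)
    (hA' : IsClosed A) {t : Fin d → ℤ} (ht : ∀ ℓ, 0 < t ℓ) {z : Fin d → ℤ}
    (hz : ¬ block t z ⊆ A) :
    ∃ ε : Fin d → Bool, ∀ j : ℕ, 1 ≤ j → block t (z + (j : ℤ) • signVector ε) ∩ A = ∅ := by
  obtain ⟨y, hy, hyA⟩ := not_subset.1 hz
  obtain ⟨f, u, hfA, hfy⟩ := geometric_hahn_banach_closed_point hA hA' hyA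
  have hsum : ∀ v : Fin d → ℝ, f v = ∑ ℓ, v ℓ * f (fun i => if ℓ = i then 1 else 0) := fun v => by
    simpa using LinearMap.pi_apply_eq_sum_univ (f : (Fin d → ℝ) →ₗ[ℝ] ℝ) v
  refine ⟨fun ℓ => decide (0 ≤ f (fun i => if ℓ = i then 1 else 0)), fun j hj => ?_⟩
  rw [← not_nonempty_iff_eq_empty]
  rintro ⟨w, hw, hwA⟩
  have : f y ≤ f w := by
    rw [hsum y, hsum w]
    refine Finset.sum_le_sum fun ℓ _ => ?_
    have h1 := hw ℓ
    have h2 := hy ℓ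
    have h3 : (0 : ℝ) < t ℓ := by exact_mod_cast ht ℓ
    have h4 : (1 : ℝ) ≤ j := by exact_mod_cast hj
    -- A shift by at least one full side moves the whole coordinate interval past `y ℓ`, wherever `y
    -- ℓ` lies in the original one.
    have h5 : (t ℓ : ℝ) ≤ j * t ℓ := le_mul_of_one_le_left h3.le h4
    by_cases hs : 0 ≤ f (fun i => if ℓ = i then 1 else 0)
    · refine mul_le_mul_of_nonneg_right ?_ hs
      simp only [signVector, hs, Pi.add_apply, Pi.smul_apply, decide_true, if_true] at h1
      push_cast [smul_eq_mul] at h1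
      nlinarith
    · refine mul_le_mul_of_nonpos_right ?_ (not_le.1 hs).le
      simp only [signVector, hs, Pi.add_apply, Pi.smul_apply, decide_false] at h1
      push_cast [smul_eq_mul] at h1
      simp at h1
      nlinarith
  linarith [hfA w hwA]

/-- The number of grid boxes that meet the boundary of a convex set is of smaller order than the
number of all boxes: a diagonal line, followed in the right direction, leaves the convex set for
good. -/
theorem card_mul_le_of_convex {A : Set (Fin d → ℝ)} (hA : Convex ℝ A) (hA' : IsClosed A)
    {t : Fin d → ℤ} (ht : ∀ ℓ, 0 < t ℓ) {R : ℕ} {Z : Finset (Fin d → ℤ)}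
    (hZR : ∀ z ∈ Z, ∀ ℓ, |z ℓ| ≤ R)
    (hZ : ∀ z ∈ Z, (block t z ∩ A).Nonempty ∧ ¬ block t z ⊆ A) :
    Z.card * R ≤ 2 ^ d * (4 * R + 1) ^ d := by
  classical
  choose! ε hε using fun z (hz : z ∈ Z) =>
    exists_signVector_block_disjoint hA hA' ht (hZ z hz).2
  -- Two diagonals of the same direction cannot collide: `z` would be a later point on the diagonal
  -- of `z'`, where boxes miss `A`, whereas the box of `z` meets `A`.
  have key : ∀ z ∈ Z, ∀ z' ∈ Z, ∀ j j' : ℕ, ε z = ε z' → j < j' →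
      z + (j : ℤ) • signVector (ε z) ≠ z' + (j' : ℤ) • signVector (ε z') := by
    intro z hz z' hz' j j' he hj heq
    have h1 : z = z' + ((j' - j : ℕ) : ℤ) • signVector (ε z') := by
      rw [he] at heq
      rw [Nat.cast_sub hj.le, sub_smul, ← add_sub_assoc, ← heq, add_sub_cancel_right]
    have h2 := hε z' hz' (j' - j) (by omega)
    rw [← h1] at h2
    exact (hZ z hz).1.ne_empty h2
  -- Fewer than `R` steps from a point of `[-R, R]^d` stay in `[-2R, 2R]^d`, which has `(4R + 1)^d`
  -- lattice points. The direction is recorded as well, since injectivity holds only for a fixed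
  -- direction.
  let T : Finset ((Fin d → Bool) × (Fin d → ℤ)) :=
    Finset.univ ×ˢ Finset.Icc (fun _ => (-(2 * R) : ℤ)) (fun _ => (2 * R : ℤ))
  have hT : T.card = 2 ^ d * (4 * R + 1) ^ d := by
    rw [Finset.card_product, Pi.card_Icc]
    simp only [Int.card_Icc, Finset.prod_const, Finset.card_univ, Fintype.card_fun,
      Fintype.card_bool, Fintype.card_fin]
    congr 2
    omega
  have hS : (Z ×ˢ Finset.range R).card = Z.card * R := by simp
  rw [← hT, ← hS]
  refine Finset.card_le_card_of_injOn
    (fun q => (ε q.1, q.1 + (q.2 : ℤ) • signVector (ε q.1))) ?_ ?_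
  · rintro ⟨z, j⟩ hq
    simp only [Finset.coe_product, mem_prod, Finset.mem_coe, Finset.mem_range] at hq
    simp only [T, Finset.coe_product, mem_prod, Finset.mem_coe, Finset.mem_univ, true_and,
      Finset.mem_Icc, Pi.le_def, Pi.add_apply, Pi.smul_apply, smul_eq_mul, signVector]
    rw [← forall_and]
    intro ℓ
    have := abs_le.1 (hZR z hq.1 ℓ)
    split_ifs <;> omega
  · rintro ⟨z, j⟩ hq ⟨z', j'⟩ hq' he
    simp only [Finset.coe_product, mem_prod, Finset.mem_coe, Finset.mem_range] at hq hq'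
    simp only [Prod.mk.injEq] at he
    rcases lt_trichotomy j j' with h | h | h
    · exact absurd he.2 (key z hq.1 z' hq'.1 j j' he.1 h)
    · subst h
      have := he.2
      rw [he.1] at this
      simpa using this
    · exact absurd he.2.symm (key z' hq'.1 z hq.1 j' j he.1.symm h)

/-- A box that meets the union without being contained in it does the same for one of the convex
parts. -/
theorem card_mul_le_of_iUnion_convex {p : ℕ} {A : Fin p → Set (Fin d → ℝ)}
    (hA : ∀ i, Convex ℝ (A i)) (hA' : ∀ i, IsClosed (A i))
    {t : Fin d → ℤ} (ht : ∀ ℓ, 0 < t ℓ) {R : ℕ} {Z : Finset (Fin d → ℤ)}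
    (hZR : ∀ z ∈ Z, ∀ ℓ, |z ℓ| ≤ R)
    (hZ : ∀ z ∈ Z, (block t z ∩ ⋃ i, A i).Nonempty ∧ ¬ block t z ⊆ ⋃ i, A i) :
    Z.card * R ≤ p * (2 ^ d * (4 * R + 1) ^ d) := by
  classical
  let Y : Fin p → Finset (Fin d → ℤ) := fun i =>
    Z.filter fun z => (block t z ∩ A i).Nonempty ∧ ¬ block t z ⊆ A i
  have hsub : Z ⊆ Finset.univ.biUnion Y := by
    intro z hz
    obtain ⟨⟨u, hu, hui⟩, h2⟩ := hZ z hz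
    obtain ⟨i, hi⟩ := mem_iUnion.1 hui
    simp only [Y, Finset.mem_biUnion, Finset.mem_univ, true_and, Finset.mem_filter]
    exact ⟨i, hz, ⟨u, hu, hi⟩, fun h => h2 (h.trans (subset_iUnion A i))⟩
  calc Z.card * R ≤ (∑ i, (Y i).card) * R :=
        Nat.mul_le_mul_right _ ((Finset.card_le_card hsub).trans Finset.card_biUnion_le)
    _ = ∑ i, (Y i).card * R := Finset.sum_mul ..
    _ ≤ ∑ _i : Fin p, 2 ^ d * (4 * R + 1) ^ d := Finset.sum_le_sum fun i _ =>
        card_mul_le_of_convex (hA i) (hA' i) ht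
          (fun z hz => hZR z (Finset.mem_filter.1 hz).1) (fun z hz => (Finset.mem_filter.1 hz).2)
    _ = _ := by simp

theorem block_eq_pi (t z : Fin d → ℤ) :
    block t z = Set.pi univ fun ℓ => Ico ((z ℓ : ℝ) * t ℓ) (((z ℓ : ℝ) + 1) * t ℓ) := by
  ext u
  simp [block, Set.mem_pi]

theorem measurableSet_block (t z : Fin d → ℤ) : MeasurableSet (block t z) := by
  rw [block_eq_pi]
  exact MeasurableSet.univ_pi fun _ => measurableSet_Ico

theorem pairwise_disjoint_block {t : Fin d → ℤ} (ht : ∀ ℓ, 0 < t ℓ) :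
    Pairwise fun z z' => Disjoint (block t z) (block t z') := by
  intro z z' hne
  rw [Set.disjoint_left]
  intro u hu hu'
  refine hne (funext fun ℓ => ?_)
  have h3 : (0 : ℝ) < t ℓ := by exact_mod_cast ht ℓ
  have h1 := (hu ℓ).1.trans_lt (hu' ℓ).2
  have h2 := (hu' ℓ).1.trans_lt (hu ℓ).2
  have h1' := lt_of_mul_lt_mul_right h1 h3.le
  have h2' := lt_of_mul_lt_mul_right h2 h3.le
  norm_cast at h1' h2'
  omega

theorem exists_mem_block {t : Fin d → ℤ} (ht : ∀ ℓ, 0 < t ℓ) (u : Fin d → ℝ) :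
    ∃ z, u ∈ block t z := by
  refine ⟨fun ℓ => ⌊u ℓ / t ℓ⌋, fun ℓ => ?_⟩
  have h3 : (0 : ℝ) < t ℓ := by exact_mod_cast ht ℓ
  rw [← le_div_iff₀ h3, ← div_lt_iff₀ h3]
  exact ⟨Int.floor_le _, Int.lt_floor_add_one _⟩

theorem abs_le_of_block_inter_nonempty {t : Fin d → ℤ} (ht : ∀ ℓ, 0 < t ℓ) {z : Fin d → ℤ}
    {C : Set (Fin d → ℝ)} {c : Fin d → ℝ} {b : ℝ} (hc : ∀ ℓ, 0 < c ℓ)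
    (hC : C ⊆ coordScale c (cube d b)) {R : ℕ} (hR : ∀ ℓ, c ℓ * b / t ℓ + 1 ≤ R)
    (hz : (block t z ∩ C).Nonempty) (ℓ : Fin d) : |z ℓ| ≤ R := by
  obtain ⟨u, hu, huC⟩ := hz
  obtain ⟨a, ha, rfl⟩ := hC huC
  have h3 : (0 : ℝ) < t ℓ := by exact_mod_cast ht ℓ
  have h1 := hu ℓ
  have h2 := ha ℓ
  simp only at h1
  have h4 : c ℓ * a ℓ ≤ c ℓ * b := mul_le_mul_of_nonneg_left h2.2 (hc ℓ).le
  have h5 : c ℓ * (-b) ≤ c ℓ * a ℓ := mul_le_mul_of_nonneg_left h2.1 (hc ℓ).le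
  have h6 : c ℓ * b ≤ (R - 1) * t ℓ := by
    rw [← div_le_iff₀ h3]; linarith [hR ℓ]
  have h7 : (z ℓ : ℝ) ≤ R - 1 := le_of_mul_le_mul_right (by linarith) h3
  have h8 : (-(R - 1) : ℝ) ≤ (z ℓ : ℝ) + 1 := le_of_mul_le_mul_right (by linarith) h3
  have : |(z ℓ : ℝ)| ≤ R := abs_le.2 ⟨by linarith, by linarith⟩
  exact_mod_cast this

/-- The measure is left general so that one argument serves both Lebesgue measure and
`latticeMeasure`, which give every box the same mass. -/
theorem card_mul_le_measureReal {ν : Measure (Fin d → ℝ)} {t : Fin d → ℤ} (ht : ∀ ℓ, 0 < t ℓ)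
    {T : ℝ} (hν : ∀ z, ν.real (block t z) = T) {C : Set (Fin d → ℝ)} (hC : ν C ≠ ⊤)
    {Z : Finset (Fin d → ℤ)} (hZ : ∀ z ∈ Z, block t z ⊆ C) : Z.card * T ≤ ν.real C := by
  have h := measureReal_biUnion_finset (μ := ν) (s := Z) (f := block t)
    ((pairwise_disjoint_block ht).set_pairwise _) (fun z _ => measurableSet_block t z)
    (fun z hz => ne_top_of_le_ne_top hC (measure_mono (hZ z hz)))
  simp only [hν, Finset.sum_const, nsmul_eq_mul] at h
  rw [← h]
  exact measureReal_mono (iUnion₂_subset hZ) hC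

theorem measureReal_le_card_mul {ν : Measure (Fin d → ℝ)} {t : Fin d → ℤ} (ht : ∀ ℓ, 0 < t ℓ)
    {T : ℝ} (hν : ∀ z, ν.real (block t z) = T) (hν' : ∀ z, ν (block t z) ≠ ⊤)
    {C : Set (Fin d → ℝ)} {Z : Finset (Fin d → ℤ)}
    (hZ : ∀ z, (block t z ∩ C).Nonempty → z ∈ Z) : ν.real C ≤ Z.card * T := by
  have hsub : C ⊆ ⋃ z ∈ Z, block t z := fun u hu => by
    obtain ⟨z, hz⟩ := exists_mem_block ht u
    exact mem_biUnion (hZ z ⟨u, hz, hu⟩) hz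
  refine (measureReal_mono hsub ?_).trans ((measureReal_biUnion_finset_le _ _).trans_eq ?_)
  · exact (measure_biUnion_lt_top Z.finite_toSet fun z _ => (hν' z).lt_top).ne
  · simp [hν]

theorem volume_real_block {t : Fin d → ℤ} (ht : ∀ ℓ, 0 < t ℓ) (z : Fin d → ℤ) :
    volume.real (block t z) = ∏ ℓ, (t ℓ : ℝ) := by
  rw [block_eq_pi, Measure.real, Real.volume_pi_Ico_toReal]
  · exact Finset.prod_congr rfl fun ℓ _ => by ring
  · intro ℓ
    have h3 : (0 : ℝ) < t ℓ := by exact_mod_cast ht ℓ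
    simp only
    nlinarith

theorem volume_block_ne_top (t z : Fin d → ℤ) : volume (block t z) ≠ ⊤ := by
  rw [block_eq_pi, Real.volume_pi_Ico]
  exact ENNReal.prod_ne_top fun _ _ => ENNReal.ofReal_ne_top

theorem latticePoints_block (t z : Fin d → ℤ) :
    latticePoints (block t z) =
      Icc (fun ℓ => z ℓ * t ℓ) (fun ℓ => (z ℓ + 1) * t ℓ - 1) := by
  ext v
  simp only [latticePoints, latticeEmb, block, mem_preimage, mem_ofPred_eq, mem_Icc, Pi.le_def,
    ← forall_and]
  refine forall_congr' fun ℓ => and_congr (by exact_mod_cast Iff.rfl) ?_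
  rw [Int.le_sub_one_iff]
  exact_mod_cast Iff.rfl

theorem card_Icc_eq_prod {a b : Fin d → ℤ} (hab : ∀ ℓ, a ℓ ≤ b ℓ + 1) :
    ((Finset.Icc a b).card : ℝ) = ∏ ℓ, (b ℓ + 1 - a ℓ : ℝ) := by
  rw [Pi.card_Icc]
  push_cast
  refine Finset.prod_congr rfl fun ℓ _ => ?_
  rw [Int.card_Icc]
  have h : ((b ℓ + 1 - a ℓ).toNat : ℤ) = b ℓ + 1 - a ℓ :=
    Int.toNat_of_nonneg (by linarith [hab ℓ])
  exact_mod_cast congrArg (Int.cast (R := ℝ)) h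

/-- The lattice points of the box `I_z`, without a margin of width `s` on the upper side. -/
noncomputable def subBlock (t s z : Fin d → ℤ) : Finset (Fin d → ℤ) :=
  Finset.Icc (fun ℓ => z ℓ * t ℓ) (fun ℓ => (z ℓ + 1) * t ℓ - 1 - s ℓ)

theorem mem_subBlock {t s z v : Fin d → ℤ} :
    v ∈ subBlock t s z ↔ ∀ ℓ, z ℓ * t ℓ ≤ v ℓ ∧ v ℓ ≤ (z ℓ + 1) * t ℓ - 1 - s ℓ := by
  simp [subBlock, Pi.le_def, forall_and]

theorem card_subBlock {t s : Fin d → ℤ} (z : Fin d → ℤ) (hs : ∀ ℓ, s ℓ ≤ t ℓ) :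
    ((subBlock t s z).card : ℝ) = ∏ ℓ, (t ℓ - s ℓ : ℝ) := by
  rw [subBlock, card_Icc_eq_prod fun ℓ => by linarith [hs ℓ]]
  refine Finset.prod_congr rfl fun ℓ _ => ?_
  push_cast
  ring

theorem coe_subBlock_zero (t z : Fin d → ℤ) :
    (subBlock t 0 z : Set (Fin d → ℤ)) = latticePoints (block t z) := by
  rw [latticePoints_block, subBlock, Finset.coe_Icc]
  simp

theorem subBlock_subset {t s : Fin d → ℤ} (hs : ∀ ℓ, 0 ≤ s ℓ) (z : Fin d → ℤ) :
    subBlock t s z ⊆ subBlock t 0 z := by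
  intro v hv
  rw [mem_subBlock] at hv ⊢
  exact fun ℓ => ⟨(hv ℓ).1, (hv ℓ).2.trans (sub_le_sub_left (hs ℓ) _)⟩

/-- The counting measure of the lattice `ℤ^d`, as a measure on `ℝ^d`. -/
noncomputable def latticeMeasure (d : ℕ) : Measure (Fin d → ℝ) :=
  Measure.count.map (latticeEmb (d := d))

theorem latticeMeasure_apply {S : Set (Fin d → ℝ)} (hS : MeasurableSet S) :
    latticeMeasure d S = (latticePoints S).encard := by
  rw [latticeMeasure, Measure.map_apply (measurable_of_countable _) hS,
    Measure.count_apply (measurable_of_countable latticeEmb hS)]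
  rfl

theorem latticeMeasure_real {S : Set (Fin d → ℝ)} (hS : MeasurableSet S) :
    (latticeMeasure d).real S = (latticePoints S).ncard := by
  rw [Measure.real, latticeMeasure_apply hS, Set.ncard]
  cases (latticePoints S).encard <;> simp

theorem latticeMeasure_block_ne_top (t z : Fin d → ℤ) : latticeMeasure d (block t z) ≠ ⊤ := by
  rw [latticeMeasure_apply (measurableSet_block t z), latticePoints_block]
  simp [Set.finite_Icc]

theorem latticeMeasure_real_block {t : Fin d → ℤ} (ht : ∀ ℓ, 0 < t ℓ) (z : Fin d → ℤ) :
    (latticeMeasure d).real (block t z) = ∏ ℓ, (t ℓ : ℝ) := by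
  rw [latticeMeasure_real (measurableSet_block t z), ← coe_subBlock_zero, Set.ncard_coe_finset,
    card_subBlock (s := 0) z fun ℓ => (ht ℓ).le]
  simp

end Geometry

/-! ### From exponential bounds to the equivalence of the two limits. -/

section Analysis

theorem exp_neg_le_one_sub {u : ℝ} (hu : u < 1) : Real.exp (-(u / (1 - u))) ≤ 1 - u := by
  have h : 0 < 1 - u := by linarith
  rw [Real.exp_neg, inv_le_comm₀ (Real.exp_pos _) h]
  have : (1 - u)⁻¹ = u / (1 - u) + 1 := by field_simp; ring
  rw [this]
  exact Real.add_one_le_exp _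

/-- The asymmetry between `hU` and `hL` is the point: convergence of `Q` to a positive limit bounds
`a` through `hU`, and this boundedness is what `hL` asks for. Both bounds are then solved for `a` by
taking logarithms. -/
theorem tendsto_iff_tendsto_exp {a Q r' ε δ : ℕ → ℝ} {θ : ℝ} (hθ : 0 < θ)
    (hr' : Tendsto r' atTop (𝓝 θ)) (hε : Tendsto ε atTop (𝓝 0)) (hδ : Tendsto δ atTop (𝓝 0))
    (hU : ∀ᶠ n in atTop, Q n ≤ Real.exp (-(a n * r' n - ε n)) + δ n)
    (hL : (∃ M, ∀ᶠ n in atTop, a n ≤ M) → ∃ r δ' : ℕ → ℝ, Tendsto r atTop (𝓝 θ) ∧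
      Tendsto δ' atTop (𝓝 0) ∧ ∀ᶠ n in atTop, Real.exp (-(a n * r n)) ≤ Q n + δ' n) (τ : ℝ) :
    Tendsto a atTop (𝓝 τ) ↔ Tendsto Q atTop (𝓝 (Real.exp (-(θ * τ)))) := by
  constructor
  · intro ha
    obtain ⟨r, δ', hr, hδ', h⟩ := hL ⟨τ + 1, (ha.eventually_lt_const (lt_add_one τ)).mono
      fun n hn => hn.le⟩
    have h1 : Tendsto (fun n => Real.exp (-(a n * r n)) - δ' n) atTop
        (𝓝 (Real.exp (-(θ * τ)))) := by
      have := ((Real.continuous_exp.tendsto _).comp (ha.mul hr).neg).sub hδ'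
      simpa [mul_comm] using this
    have h2 : Tendsto (fun n => Real.exp (-(a n * r' n - ε n)) + δ n) atTop
        (𝓝 (Real.exp (-(θ * τ)))) := by
      have := ((Real.continuous_exp.tendsto _).comp ((ha.mul hr').sub hε).neg).add hδ
      simpa [mul_comm] using this
    refine tendsto_of_tendsto_of_tendsto_of_le_of_le' h1 h2 ?_ hU
    filter_upwards [h] with n hn using by linarith
  · intro hQ
    have hexp := Real.exp_pos (-(θ * τ))
    have hlim : θ * τ / θ = τ := by field_simp
    have h2 : Tendsto (fun n => (-Real.log (Q n - δ n) + ε n) / r' n) atTop (𝓝 τ) := by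
      have h := (hQ.sub hδ).log (by simp)
      have := (h.neg.add hε).div hr' hθ.ne'
      simpa [hlim, Pi.div_def] using this
    have hle : ∀ᶠ n in atTop, a n ≤ (-Real.log (Q n - δ n) + ε n) / r' n := by
      have hpos : ∀ᶠ n in atTop, 0 < Q n - δ n :=
        (hQ.sub hδ).eventually_const_lt (by simpa using hexp)
      filter_upwards [hU, hpos, hr'.eventually_const_lt hθ] with n h1 h2 h3
      rw [le_div_iff₀ h3]
      have := (Real.log_le_iff_le_exp h2).2 (show Q n - δ n ≤ _ by linarith)
      linarith
    obtain ⟨r, δ', hr, hδ', h⟩ := hL ⟨τ + 1, by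
      filter_upwards [hle, h2.eventually_lt_const (lt_add_one τ)] with n h3 h4
      exact h3.trans h4.le⟩
    have h1 : Tendsto (fun n => -Real.log (Q n + δ' n) / r n) atTop (𝓝 τ) := by
      have h := (hQ.add hδ').log (by simp)
      have := h.neg.div hr hθ.ne'
      simpa [hlim, Pi.div_def] using this
    refine tendsto_of_tendsto_of_tendsto_of_le_of_le' h1 h2 ?_ hle
    filter_upwards [h, hr.eventually_const_lt hθ] with n h3 h4
    rw [div_le_iff₀ h4]
    have := Real.le_log_iff_exp_le ((Real.exp_pos _).trans_le h3) |>.2 h3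
    linarith

/-- A power `q ^ N` with `1 - q` of order `1 / N` is bounded below by an exponential. -/
theorem exists_exp_le_of_pow_le {a Q q s δ w u : ℕ → ℝ} {N : ℕ → ℕ} {θ : ℝ}
    (ha0 : ∀ n, 0 ≤ a n) (hN : Tendsto N atTop atTop)
    (hs : Tendsto s atTop (𝓝 θ)) (hδ : Tendsto δ atTop (𝓝 0)) (hw : Tendsto w atTop (𝓝 0))
    (hu : ∀ᶠ n in atTop, N n * u n = a n * s n) (hq : ∀ᶠ n in atTop, 1 - u n ≤ q n)
    (hQ : ∀ᶠ n in atTop, q n ^ N n ≤ Q n + δ n + a n * w n)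
    (hM : ∃ M, ∀ᶠ n in atTop, a n ≤ M) :
    ∃ r δ' : ℕ → ℝ, Tendsto r atTop (𝓝 θ) ∧
      Tendsto δ' atTop (𝓝 0) ∧ ∀ᶠ n in atTop, Real.exp (-(a n * r n)) ≤ Q n + δ' n := by
  obtain ⟨M, hM⟩ := hM
  have hbdd : IsBoundedUnder (· ≤ ·) atTop fun n => ‖a n‖ := by
    refine ⟨M, eventually_map.2 (hM.mono fun n hn => ?_)⟩
    rwa [Real.norm_of_nonneg (ha0 n)]
  have hN' : Tendsto (fun n => (N n : ℝ)) atTop atTop := tendsto_natCast_atTop_atTop.comp hN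
  have haw : Tendsto (fun n => a n * w n) atTop (𝓝 0) := isBoundedUnder_le_mul_tendsto_zero hbdd hw
  -- By `hu`, `u = a * s / N` eventually, with `a` bounded, `s` convergent and `N → ∞`.
  have hu0 : Tendsto u atTop (𝓝 0) := by
    have h1 : Tendsto (fun n => a n * (s n / N n)) atTop (𝓝 0) :=
      isBoundedUnder_le_mul_tendsto_zero hbdd (hs.div_atTop hN')
    refine h1.congr' ?_
    filter_upwards [hu, hN'.eventually_gt_atTop 0] with n h2 h3
    rw [← mul_div_assoc, ← h2]
    field_simp
  -- The factor `1 / (1 - u)` is the price of bounding `1 - u` below by an exponential, and it tends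
  -- to `1`.
  refine ⟨fun n => s n / (1 - u n), fun n => δ n + a n * w n, ?_, ?_, ?_⟩
  · simpa [Pi.div_def] using hs.div (hu0.const_sub 1) (by simp)
  · simpa using hδ.add haw
  · filter_upwards [hu, hq, hQ, hu0.eventually_lt_const one_pos] with n h1 h2 h3 h4
    calc Real.exp (-(a n * (s n / (1 - u n)))) = Real.exp (-(u n / (1 - u n))) ^ N n := by
          rw [← Real.exp_nat_mul, ← mul_div_assoc, ← h1]
          congr 1
          ring
      _ ≤ (1 - u n) ^ N n := pow_le_pow_left₀ (Real.exp_pos _).le (exp_neg_le_one_sub h4) _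
      _ ≤ q n ^ N n := pow_le_pow_left₀ (by linarith) h2 _
      _ ≤ _ := by linarith

end Analysis

/-! ### Finite bounds for one block and for a family of blocks. -/

section BlockBounds

variable {d : ℕ} {Ω : Type*} [MeasurableSpace Ω] {μ : Measure Ω} [IsProbabilityMeasure μ]
  {ξ : (Fin d → ℤ) → Ω → ℝ}

/-- In a coordinate where the indices differ, the margin at the top of the lower box lies between
the two points. A margin on one side is thus enough. -/
theorem exists_lt_abs_sub_of_mem_subBlock {t s : Fin d → ℤ} {γ : Fin d → ℝ} (ht : ∀ ℓ, 0 < t ℓ)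
    (hγs : ∀ ℓ, γ ℓ ≤ s ℓ) {z z' : Fin d → ℤ} (hz : z ≠ z') {a b : Fin d → ℤ}
    (ha : a ∈ subBlock t s z) (hb : b ∈ subBlock t s z') : ∃ ℓ, γ ℓ < |(b ℓ : ℝ) - a ℓ| := by
  obtain ⟨ℓ, hℓ⟩ := Function.ne_iff.1 hz
  have ha := mem_subBlock.1 ha ℓ
  have hb := mem_subBlock.1 hb ℓ
  refine ⟨ℓ, (hγs ℓ).trans_lt ?_⟩
  have : s ℓ < |b ℓ - a ℓ| := by
    rw [lt_abs]
    rcases lt_or_gt_of_ne hℓ with h | h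
    · left
      nlinarith [ht ℓ, mul_le_mul_of_nonneg_right (Int.add_one_le_iff.2 h) (ht ℓ).le]
    · right
      nlinarith [ht ℓ, mul_le_mul_of_nonneg_right (Int.add_one_le_iff.2 h) (ht ℓ).le]
  exact_mod_cast this

theorem abs_measureReal_iUnion_subBlock_sub_pow_le (hmeas : ∀ v, Measurable (ξ v))
    (hstat : IsStationary μ ξ) {K : Set (Fin d → ℤ)} {x α : ℝ} {γ : Fin d → ℝ}
    (hγ : ∀ ℓ, 0 ≤ γ ℓ)
    (hmix : ∀ A B : Set (Fin d → ℤ), A ⊆ K → B ⊆ K → Separated γ A B → (IsBox A ∨ IsBox B) →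
      |μ.real {ω | fieldMax ξ (A ∪ B) ω ≤ x} -
        μ.real {ω | fieldMax ξ A ω ≤ x} * μ.real {ω | fieldMax ξ B ω ≤ x}| ≤ α)
    {t s : Fin d → ℤ} (ht : ∀ ℓ, 0 < t ℓ) (hγs : ∀ ℓ, γ ℓ ≤ s ℓ) {Z : Finset (Fin d → ℤ)}
    (hZ : ∀ z ∈ Z, (subBlock t s z : Set (Fin d → ℤ)) ⊆ K) :
    |μ.real {ω | fieldMax ξ (⋃ z ∈ Z, (subBlock t s z : Set (Fin d → ℤ))) ω ≤ x} -
      μ.real {ω | fieldMax ξ (subBlock t s 0) ω ≤ x} ^ Z.card| ≤ Z.card * α := by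
  have h := abs_measureReal_biUnion_sub_prod_le Z
    (fun z => (subBlock t s z : Set (Fin d → ℤ))) hγ hmix
    (fun z _ => ⟨_, _, Finset.coe_Icc _ _⟩) hZ
    (fun z _ z' _ hne a ha b hb => exists_lt_abs_sub_of_mem_subBlock ht hγs hne ha hb)
  rwa [Finset.prod_congr rfl fun z _ =>
    hstat.measureReal_fieldMax_le hmeas (fun ℓ => z ℓ * t ℓ) (A := (subBlock t s 0)) x
      fun v => ?_, Finset.prod_const] at h
  simp only [Finset.mem_coe, mem_subBlock, Pi.add_apply, Pi.zero_apply, zero_mul, zero_add,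
    one_mul]
  refine forall_congr' fun ℓ => ?_
  constructor <;> rintro ⟨h1, h2⟩ <;> constructor <;> linarith

theorem measureReal_fieldMax_le_pow_add (hmeas : ∀ v, Measurable (ξ v))
    (hstat : IsStationary μ ξ) {K : Set (Fin d → ℤ)} {x α : ℝ} {γ : Fin d → ℝ}
    (hγ : ∀ ℓ, 0 ≤ γ ℓ)
    (hmix : ∀ A B : Set (Fin d → ℤ), A ⊆ K → B ⊆ K → Separated γ A B → (IsBox A ∨ IsBox B) →
      |μ.real {ω | fieldMax ξ (A ∪ B) ω ≤ x} -
        μ.real {ω | fieldMax ξ A ω ≤ x} * μ.real {ω | fieldMax ξ B ω ≤ x}| ≤ α)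
    {t s : Fin d → ℤ} (ht : ∀ ℓ, 0 < t ℓ) (hγs : ∀ ℓ, γ ℓ ≤ s ℓ) {Z : Finset (Fin d → ℤ)}
    {D : Set (Fin d → ℤ)} (hZ : ∀ z ∈ Z, (subBlock t s z : Set (Fin d → ℤ)) ⊆ K)
    (hD : ∀ z ∈ Z, (subBlock t s z : Set (Fin d → ℤ)) ⊆ D) :
    μ.real {ω | fieldMax ξ D ω ≤ x} ≤
      μ.real {ω | fieldMax ξ (subBlock t s 0) ω ≤ x} ^ Z.card + Z.card * α := by
  have h1 := abs_measureReal_iUnion_subBlock_sub_pow_le hmeas hstat hγ hmix ht hγs hZ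
  have h2 : μ.real {ω | fieldMax ξ D ω ≤ x} ≤
      μ.real {ω | fieldMax ξ (⋃ z ∈ Z, (subBlock t s z : Set (Fin d → ℤ))) ω ≤ x} :=
    measureReal_mono fun ω hω => (fieldMax_mono (iUnion₂_subset hD) ω).trans hω
  linarith [(abs_le.1 h1).2]

/-- An exceedance in `D` falls in a core or in a margin. The last term is the union bound over all
margin points. -/
theorem pow_le_measureReal_fieldMax_add (hmeas : ∀ v, Measurable (ξ v))
    (hstat : IsStationary μ ξ) {K : Set (Fin d → ℤ)} {x α : ℝ} {γ : Fin d → ℝ}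
    (hγ : ∀ ℓ, 0 ≤ γ ℓ)
    (hmix : ∀ A B : Set (Fin d → ℤ), A ⊆ K → B ⊆ K → Separated γ A B → (IsBox A ∨ IsBox B) →
      |μ.real {ω | fieldMax ξ (A ∪ B) ω ≤ x} -
        μ.real {ω | fieldMax ξ A ω ≤ x} * μ.real {ω | fieldMax ξ B ω ≤ x}| ≤ α)
    {t s : Fin d → ℤ} (ht : ∀ ℓ, 0 < t ℓ) (hs : ∀ ℓ, 0 ≤ s ℓ) (hst : ∀ ℓ, s ℓ ≤ t ℓ)
    (hγs : ∀ ℓ, γ ℓ ≤ s ℓ)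
    {Z : Finset (Fin d → ℤ)} {D : Set (Fin d → ℤ)}
    (hZ : ∀ z ∈ Z, (subBlock t s z : Set (Fin d → ℤ)) ⊆ K)
    (hD : D ⊆ ⋃ z ∈ Z, (subBlock t 0 z : Set (Fin d → ℤ))) :
    μ.real {ω | fieldMax ξ (subBlock t s 0) ω ≤ x} ^ Z.card ≤
      μ.real {ω | fieldMax ξ D ω ≤ x} + Z.card * α +
        Z.card * (∏ ℓ, (t ℓ : ℝ) - ∏ ℓ, (t ℓ - s ℓ : ℝ)) * μ.real {ω | x < ξ 0 ω} := by
  classical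
  have h1 := abs_measureReal_iUnion_subBlock_sub_pow_le hmeas hstat hγ hmix ht hγs hZ
  let B : Finset (Fin d → ℤ) := Z.biUnion fun z => subBlock t 0 z \ subBlock t s z
  have hB : (B.card : ℝ) ≤ Z.card * (∏ ℓ, (t ℓ : ℝ) - ∏ ℓ, (t ℓ - s ℓ : ℝ)) := by
    have h : (B.card : ℝ) ≤ ∑ z ∈ Z, ((subBlock t 0 z \ subBlock t s z).card : ℝ) := by
      exact_mod_cast Finset.card_biUnion_le
    refine h.trans_eq ?_
    rw [Finset.sum_congr rfl fun z _ => by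
      rw [Finset.cast_card_sdiff (subBlock_subset hs z), card_subBlock z hst,
        card_subBlock (s := 0) z fun ℓ => (ht ℓ).le], Finset.sum_const, nsmul_eq_mul]
    simp
  have hcov : {ω | x < fieldMax ξ D ω} ⊆
      {ω | x < fieldMax ξ (⋃ z ∈ Z, (subBlock t s z : Set (Fin d → ℤ))) ω} ∪
        {ω | x < fieldMax ξ B ω} := by
    intro ω hω
    obtain ⟨v, hv, hlt⟩ := lt_fieldMax_iff.1 hω
    obtain ⟨z, hz, hvz⟩ := mem_iUnion₂.1 (hD hv)
    by_cases hvs : v ∈ subBlock t s z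
    · exact Or.inl (lt_fieldMax_iff.2 ⟨v, mem_iUnion₂.2 ⟨z, hz, hvs⟩, hlt⟩)
    · refine Or.inr (lt_fieldMax_iff.2 ⟨v, ?_, hlt⟩)
      simp only [B, Finset.mem_coe, Finset.mem_biUnion, Finset.mem_sdiff]
      exact ⟨z, hz, hvz, hvs⟩
  have h2 := (measureReal_mono (μ := μ) hcov).trans (measureReal_union_le _ _)
  rw [measureReal_lt_fieldMax hmeas, measureReal_lt_fieldMax hmeas] at h2
  have h3 := (measureReal_lt_fieldMax_le hstat hmeas B x).trans
    (mul_le_mul_of_nonneg_right hB measureReal_nonneg)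
  linarith [(abs_le.1 h1).1]

/-- Differences of two points of the core lie in the box of half sides `t`, so exceedances without a
positive neighbour exceeding in that box are disjoint events over the core. Passing from these
neighbours to `S` costs exactly the anti-clustering event. -/
theorem measureReal_fieldMax_subBlock_le (hmeas : ∀ v, Measurable (ξ v))
    (hstat : IsStationary μ ξ) {prec : (Fin d → ℤ) → (Fin d → ℤ) → Prop}
    (hprec : IsTranslationInvariantOrder prec) {t s : Fin d → ℤ}
    (hs : ∀ ℓ, 0 ≤ s ℓ) (hst : ∀ ℓ, s ℓ ≤ t ℓ) (x : ℝ) (S : Set (Fin d → ℤ)) :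
    μ.real {ω | fieldMax ξ (subBlock t s 0) ω ≤ x} ≤
      1 - (∏ ℓ, (t ℓ - s ℓ : ℝ)) * (μ.real {ω | x < ξ 0 ω ∧ fieldMax ξ S ω ≤ x} -
        μ.real {ω | fieldMax ξ S ω ≤ x ∧ x < ξ 0 ω ∧
          x < fieldMax ξ (positiveNeighbors prec t \ S) ω}) := by
  have h1 := card_mul_le_measureReal_lt_fieldMax hstat hmeas hprec (subBlock t s 0)
    (positiveNeighbors prec t) (fun v hv w hw hvw => ⟨fun ℓ => ?_, ?_⟩) x
  · rw [card_subBlock 0 hst, measureReal_lt_fieldMax hmeas] at h1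
    have h2 : μ.real {ω | x < ξ 0 ω ∧ fieldMax ξ S ω ≤ x} ≤
        μ.real {ω | x < ξ 0 ω ∧ fieldMax ξ (positiveNeighbors prec t) ω ≤ x} +
        μ.real {ω | fieldMax ξ S ω ≤ x ∧ x < ξ 0 ω ∧
          x < fieldMax ξ (positiveNeighbors prec t \ S) ω} := by
      refine (measureReal_mono ?_).trans (measureReal_union_le _ _)
      rintro ω ⟨h3, h4⟩
      by_cases h5 : fieldMax ξ (positiveNeighbors prec t) ω ≤ x
      · exact Or.inl ⟨h3, h5⟩
      · obtain ⟨v, hv, hlt⟩ := lt_fieldMax_iff.1 (not_le.1 h5)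
        refine Or.inr ⟨h4, h3, lt_fieldMax_iff.2 ⟨v, ⟨hv, fun hvS => ?_⟩, hlt⟩⟩
        exact absurd hlt (not_lt.2 (fieldMax_le_iff.1 h4 v hvS))
    have h3 : (0 : ℝ) ≤ ∏ ℓ, (t ℓ - s ℓ : ℝ) :=
      Finset.prod_nonneg fun ℓ _ => sub_nonneg.2 (by exact_mod_cast hst ℓ)
    nlinarith
  · have := mem_subBlock.1 hv ℓ
    have := mem_subBlock.1 hw ℓ
    have := hs ℓ
    simp only [Pi.zero_apply, zero_mul, zero_add, one_mul, Pi.sub_apply] at *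
    omega
  · simpa [sub_eq_add_neg] using hprec.add_right v w (-v) hvw

/-- The last-exceedance union bound, with `I` the points of the core at distance at least `m` from
its faces. Removing `m` on both sides explains `2 * m`. -/
theorem le_measureReal_fieldMax_subBlock (hmeas : ∀ v, Measurable (ξ v))
    (hstat : IsStationary μ ξ) {prec : (Fin d → ℤ) → (Fin d → ℤ) → Prop}
    (hprec : IsTranslationInvariantOrder prec) {t s : Fin d → ℤ} (m : ℕ)
    (hst : ∀ ℓ, s ℓ + 2 * m ≤ t ℓ) (x : ℝ) :
    1 - ((∏ ℓ, (t ℓ - s ℓ : ℝ)) * μ.real {ω | x < ξ 0 ω ∧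
        fieldMax ξ (positiveNeighbors prec fun _ => (m : ℤ)) ω ≤ x} +
      (∏ ℓ, (t ℓ - s ℓ : ℝ) - ∏ ℓ, (t ℓ - (s ℓ + 2 * m : ℤ) : ℝ)) * μ.real {ω | x < ξ 0 ω}) ≤
    μ.real {ω | fieldMax ξ (subBlock t s 0) ω ≤ x} := by
  let I : Finset (Fin d → ℤ) := Finset.Icc (fun _ => (m : ℤ)) (fun ℓ => t ℓ - 1 - s ℓ - m)
  have hmemI : ∀ v, v ∈ I ↔ ∀ ℓ, (m : ℤ) ≤ v ℓ ∧ v ℓ ≤ t ℓ - 1 - s ℓ - m := fun v => by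
    simp [I, Pi.le_def, forall_and]
  have hI : (I.card : ℝ) = ∏ ℓ, (t ℓ - (s ℓ + 2 * m : ℤ) : ℝ) := by
    rw [card_Icc_eq_prod fun ℓ => by linarith [hst ℓ]]
    refine Finset.prod_congr rfl fun ℓ _ => ?_
    push_cast
    ring
  have h := measureReal_lt_fieldMax_le_card_mul hstat hmeas hprec (I := I) (J := subBlock t s 0)
    (fun v hv => mem_subBlock.2 fun ℓ => ?_) (positiveNeighbors prec fun _ => (m : ℤ))
    (fun w hw => hw.2) (fun v hv w hw => mem_subBlock.2 fun ℓ => ?_) x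
  · rw [hI, card_subBlock 0 (fun ℓ => by linarith [hst ℓ]), measureReal_lt_fieldMax hmeas] at h
    linarith
  · have := (hmemI v).1 hv ℓ
    simp only [Pi.zero_apply, zero_mul, zero_add, one_mul]
    omega
  · have := (hmemI v).1 hv ℓ
    have hwℓ : -(m : ℤ) ≤ w ℓ ∧ w ℓ ≤ m := hw.1 ℓ
    simp only [Pi.zero_apply, zero_mul, zero_add, one_mul, Pi.add_apply]
    omega

theorem measureReal_and_eq_mul_cond (hmeas : ∀ v, Measurable (ξ v)) (S : Set (Fin d → ℤ))
    (x : ℝ) :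
    μ.real {ω | x < ξ 0 ω ∧ fieldMax ξ S ω ≤ x} =
      μ.real {ω | x < ξ 0 ω} * (μ[|{ω | x < ξ 0 ω}]).real {ω | fieldMax ξ S ω ≤ x} := by
  rw [mul_comm, Measure.real, Measure.real, Measure.real, ← ENNReal.toReal_mul,
    cond_mul_eq_inter (measurableSet_exceed hmeas 0 x)]
  rfl

end BlockBounds

/-! ### Growth of block sides and asymptotic block counts. -/

section BlockAsymptotics

variable {d : ℕ}

/-- If separation vectors bounded away from `0` are negligible relative to the block sides, then
the block sides tend to infinity. -/
theorem tendsto_atTop_of_sep {κ γ c : ℕ → ℝ} {g : ℝ} (hg : 0 < g) (hγ : ∀ n, g ≤ γ n)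
    (hκ : ∀ᶠ n in atTop, 0 < κ n) (hc : ∀ n, 0 < c n)
    (h : Tendsto (fun n => κ n * γ n / c n) atTop (𝓝 0)) :
    Tendsto (fun n => c n / κ n) atTop atTop := by
  have h1 : Tendsto (fun n => κ n / c n) atTop (𝓝[>] 0) := by
    refine tendsto_nhdsWithin_iff.2 ⟨?_, hκ.mono fun n hn => div_pos hn (hc n)⟩
    have h2 : Tendsto (fun n => κ n * γ n / c n / g) atTop (𝓝 0) := by simpa using h.div_const g
    refine tendsto_of_tendsto_of_tendsto_of_le_of_le' tendsto_const_nhds h2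
      (hκ.mono fun n hn => (div_pos hn (hc n)).le) (hκ.mono fun n hn => ?_)
    rw [le_div_iff₀ hg, div_mul_eq_mul_div]
    have := hc n
    have := hγ n
    gcongr
  refine h1.inv_tendsto_nhdsGT_zero.congr fun n => ?_
  simp

theorem tendsto_intFloor_div {y : ℕ → ℝ} (hy : Tendsto y atTop atTop) :
    Tendsto (fun n => (⌊y n⌋ : ℝ) / y n) atTop (𝓝 1) := by
  refine (tendsto_nat_floor_div_atTop.comp hy).congr' ?_
  filter_upwards [hy.eventually_ge_atTop 0] with n hn
  simp only [Function.comp]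
  rw [← natCast_floor_eq_intCast_floor hn]

theorem tendsto_prod_sub_div_prod {ι : Type*} [Fintype ι] {t s : ℕ → ι → ℝ}
    (ht : ∀ ℓ, ∀ᶠ n in atTop, 0 < t n ℓ)
    (hs : ∀ ℓ, Tendsto (fun n => s n ℓ / t n ℓ) atTop (𝓝 0)) :
    Tendsto (fun n => (∏ ℓ, (t n ℓ - s n ℓ)) / ∏ ℓ, t n ℓ) atTop (𝓝 1) := by
  have h := tendsto_finsetProd (Finset.univ : Finset ι) fun ℓ _ => (hs ℓ).const_sub 1
  simp only [sub_zero, Finset.prod_const_one] at h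
  refine h.congr' ?_
  filter_upwards [eventually_all.2 ht] with n hn
  rw [← Finset.prod_div_distrib]
  refine Finset.prod_congr rfl fun ℓ _ => ?_
  have := (hn ℓ).ne'
  field_simp

/-- Grid counting: the numbers of boxes inside and meeting `C n` are both asymptotic to `k n`. -/
theorem exists_block_counts (hd : 1 ≤ d) {D : ℕ → Set (Fin d → ℤ)} {p : ℕ}
    {Cpart : ℕ → Fin p → Set (Fin d → ℝ)} {C : ℕ → Set (Fin d → ℝ)} {c : ℕ → Fin d → ℝ}
    (hD : GeometricAssumption D Cpart C c) {k : ℕ → ℕ} (hk : Tendsto k atTop atTop)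
    (hck : ∀ ℓ, Tendsto (fun n => c n ℓ / (k n : ℝ) ^ ((1 : ℝ) / d)) atTop atTop) :
    ∃ Zi Zo : ℕ → Finset (Fin d → ℤ), (∀ n, Zi n ⊆ Zo n) ∧
      (∀ n, ∀ z ∈ Zi n, block (blockSide (c n) (k n)) z ⊆ C n) ∧
      (∀ n, ∀ z ∈ Zo n, (block (blockSide (c n) (k n)) z ∩ C n).Nonempty) ∧
      (∀ᶠ n in atTop, ∀ z, (block (blockSide (c n) (k n)) z ∩ C n).Nonempty → z ∈ Zo n) ∧
      Tendsto (fun n => ((Zi n).card : ℝ) / k n) atTop (𝓝 1) ∧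
      Tendsto (fun n => ((Zo n).card : ℝ) / k n) atTop (𝓝 1) ∧
      Tendsto (fun n => ((D n).ncard : ℝ) / (k n * ∏ ℓ, (blockSide (c n) (k n) ℓ : ℝ)))
        atTop (𝓝 1) := by
  classical
  obtain ⟨b, hb, hCb⟩ := hD.subset_box
  set κ : ℕ → ℝ := fun n => (k n : ℝ) ^ ((1 : ℝ) / d) with hκdef
  set t : ℕ → Fin d → ℤ := fun n => blockSide (c n) (k n) with htdef
  have hd0 : (0 : ℝ) < d := by exact_mod_cast hd
  have hkR : Tendsto (fun n => (k n : ℝ)) atTop atTop := tendsto_natCast_atTop_atTop.comp hk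
  have hκ : Tendsto κ atTop atTop := (tendsto_rpow_atTop (by positivity)).comp hkR
  have hκd : ∀ n, κ n ^ d = k n := fun n => by
    rw [hκdef, ← Real.rpow_natCast, ← Real.rpow_mul (Nat.cast_nonneg _),
      one_div_mul_cancel hd0.ne', Real.rpow_one]
  have htc : ∀ ℓ, Tendsto (fun n => (t n ℓ : ℝ) / (c n ℓ / κ n)) atTop (𝓝 1) := fun ℓ =>
    tendsto_intFloor_div (hck ℓ)
  have htpos : ∀ᶠ n in atTop, ∀ ℓ, 0 < t n ℓ := eventually_all.2 fun ℓ => by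
    filter_upwards [(hck ℓ).eventually_ge_atTop 1] with n hn
    exact Int.floor_pos.2 hn
  have hkpos : ∀ᶠ n in atTop, (0 : ℝ) < k n := hkR.eventually_gt_atTop 0
  -- volumes
  have hkT : Tendsto (fun n => (k n * ∏ ℓ, (t n ℓ : ℝ)) / ∏ ℓ, c n ℓ) atTop (𝓝 1) := by
    have h := tendsto_finsetProd (Finset.univ : Finset (Fin d)) fun ℓ _ => htc ℓ
    simp only [Finset.prod_const_one] at h
    refine h.congr fun n => ?_
    rw [Finset.prod_div_distrib, Finset.prod_div_distrib, Finset.prod_const, Finset.card_univ,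
      Fintype.card_fin, hκd, div_div_eq_mul_div, mul_comm]
  have hvol : Tendsto (fun n => volume.real (C n) / (k n * ∏ ℓ, (t n ℓ : ℝ))) atTop (𝓝 1) := by
    have h1 : Tendsto (fun n => (∏ ℓ, c n ℓ) / volume.real (C n)) atTop (𝓝 1) :=
      (Asymptotics.isEquivalent_iff_tendsto_one
        (hD.volume_tendsto.eventually_ne_atTop 0)).1 hD.scale_equivalent
    have h2 := (h1.mul hkT).inv₀ (by simp)
    simp only [mul_one, inv_one] at h2
    refine h2.congr' ?_
    filter_upwards [hD.volume_tendsto.eventually_gt_atTop 0, hkpos, htpos] with n h3 h4 h5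
    have h6 : 0 < ∏ ℓ, c n ℓ := Finset.prod_pos fun ℓ _ => hD.scale_pos n ℓ
    have h7 : 0 < ∏ ℓ, (t n ℓ : ℝ) := Finset.prod_pos fun ℓ _ => by exact_mod_cast h5 ℓ
    field_simp
  -- the range of the grid
  let B : ℝ := 2 * b + 1
  have hB : 0 < B := by positivity
  let R : ℕ → ℕ := fun n => ⌈B * κ n⌉₊
  have hBR : ∀ n, B * κ n ≤ R n := fun n => Nat.le_ceil _
  have hRtop : Tendsto (fun n => (R n : ℝ)) atTop atTop :=
    tendsto_atTop_mono hBR (hκ.const_mul_atTop hB)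
  -- Rounding down eventually keeps at least half of `c / κ`, so `c * b / t ≤ 2 * b * κ`. The extra
  -- `1` is absorbed by `κ ≥ 1`; hence `B = 2 * b + 1`.
  have hR : ∀ᶠ n in atTop, ∀ ℓ, c n ℓ * b / t n ℓ + 1 ≤ R n := eventually_all.2 fun ℓ => by
    filter_upwards [hκ.eventually_ge_atTop 1, htpos,
      (htc ℓ).eventually_const_lt (show (1 / 2 : ℝ) < 1 by norm_num)] with n h1 h2 h3
    have h4 : (0 : ℝ) < t n ℓ := by exact_mod_cast h2 ℓ
    have h5 := hD.scale_pos n ℓ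
    rw [lt_div_iff₀ (by positivity)] at h3
    have h6 : c n ℓ ≤ 2 * κ n * t n ℓ := by
      have : c n ℓ / κ n ≤ 2 * t n ℓ := by linarith
      rw [div_le_iff₀ (by positivity)] at this
      linarith
    have h7 : c n ℓ * b / t n ℓ ≤ 2 * b * κ n := by
      rw [div_le_iff₀ h4]
      nlinarith
    calc _ ≤ 2 * b * κ n + κ n := by linarith
      _ = B * κ n := by ring
      _ ≤ _ := hBR n
  have hRup : ∀ᶠ n in atTop, (R n : ℝ) ≤ 2 * B * κ n := by
    filter_upwards [hκ.eventually_ge_atTop (1 / B)] with n h1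
    rw [div_le_iff₀' hB] at h1
    linarith [(Nat.ceil_lt_add_one (by linarith : 0 ≤ B * κ n)).le]
  let Zo : ℕ → Finset (Fin d → ℤ) := fun n =>
    (Finset.Icc (fun _ => -(R n : ℤ)) (fun _ => (R n : ℤ))).filter
      fun z => (block (t n) z ∩ C n).Nonempty
  let Zi : ℕ → Finset (Fin d → ℤ) := fun n => (Zo n).filter fun z => block (t n) z ⊆ C n
  have hZo : ∀ n, ∀ z ∈ Zo n, (∀ ℓ, |z ℓ| ≤ R n) ∧ (block (t n) z ∩ C n).Nonempty := by
    intro n z hz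
    simp only [Zo, Finset.mem_filter, Finset.mem_Icc, Pi.le_def] at hz
    exact ⟨fun ℓ => abs_le.2 ⟨hz.1.1 ℓ, hz.1.2 ℓ⟩, hz.2⟩
  have hZo' : ∀ᶠ n in atTop, ∀ z, (block (t n) z ∩ C n).Nonempty → z ∈ Zo n := by
    filter_upwards [htpos, hR] with n h1 h2 z hz
    have h := abs_le_of_block_inter_nonempty h1 (hD.scale_pos n) (hCb n) h2 hz
    simp only [Zo, Finset.mem_filter, Finset.mem_Icc, Pi.le_def]
    exact ⟨⟨fun ℓ => (abs_le.1 (h ℓ)).1, fun ℓ => (abs_le.1 (h ℓ)).2⟩, hz⟩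
  have hZi : ∀ n, ∀ z ∈ Zi n, block (t n) z ⊆ C n := fun n z hz => (Finset.mem_filter.1 hz).2
  have hZio : ∀ n, Zi n ⊆ Zo n := fun n => Finset.filter_subset _ _
  -- boundary boxes
  have hbd : Tendsto (fun n => ((Zo n).card - (Zi n).card : ℝ) / k n) atTop (𝓝 0) := by
    -- Since `4R + 1 ≤ 5R` and `R ≤ 2Bκ` with `κ ^ d = k`, the diagonal count bounds the boundary
    -- boxes by a constant times `k / R`.
    have hlim : Tendsto (fun n => (p * (2 ^ d * (5 * (2 * B)) ^ d) : ℝ) / R n) atTop (𝓝 0) :=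
      hRtop.const_div_atTop _
    refine squeeze_zero' ?_ ?_ hlim
    · filter_upwards [hkpos] with n h1
      exact div_nonneg (sub_nonneg.2 (by exact_mod_cast Finset.card_le_card (hZio n))) h1.le
    · filter_upwards [hkpos, htpos, hRup, hRtop.eventually_ge_atTop 1] with n h1 h2 h3 h4
      have h5 := card_mul_le_of_iUnion_convex (A := Cpart n) (R := R n) (Z := Zo n \ Zi n)
        (fun i => (hD.convexBody n i).convex) (fun i => (hD.convexBody n i).isCompact.isClosed)
        h2 (fun z hz => (hZo n z (Finset.mem_sdiff.1 hz).1).1) (fun z hz => by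
          rw [← hD.eq_union n]
          rw [Finset.mem_sdiff] at hz
          exact ⟨(hZo n z hz.1).2, fun h => hz.2 (Finset.mem_filter.2 ⟨hz.1, h⟩)⟩)
      have h6 : ((Zo n \ Zi n).card : ℝ) * R n ≤ p * (2 ^ d * (4 * R n + 1) ^ d) := by
        exact_mod_cast h5
      rw [Finset.cast_card_sdiff (hZio n)] at h6
      rw [div_le_div_iff₀ h1 (by linarith)]
      refine h6.trans ?_
      have h7 : (4 * R n + 1 : ℝ) ^ d ≤ (5 * (2 * B)) ^ d * k n := by
        rw [← hκd n, ← mul_pow]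
        exact pow_le_pow_left₀ (by positivity) (by linarith) _
      calc (p * (2 ^ d * (4 * R n + 1) ^ d) : ℝ) ≤ p * (2 ^ d * ((5 * (2 * B)) ^ d * k n)) := by
            gcongr
        _ = _ := by ring
  have hCc : ∀ n, IsCompact (C n) := fun n => by
    rw [hD.eq_union n]
    exact isCompact_iUnion fun i => (hD.convexBody n i).isCompact
  have hT : ∀ᶠ n in atTop, (0 : ℝ) < ∏ ℓ, (t n ℓ : ℝ) := htpos.mono fun n hn =>
    Finset.prod_pos fun ℓ _ => by exact_mod_cast hn ℓ
  have hi_le : ∀ᶠ n in atTop,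
      ((Zi n).card : ℝ) / k n ≤ volume.real (C n) / (k n * ∏ ℓ, (t n ℓ : ℝ)) := by
    filter_upwards [htpos, hT, hkpos] with n h1 h2 h3
    rw [← div_div, div_right_comm]
    refine div_le_div_of_nonneg_right ?_ h3.le
    rw [le_div_iff₀ h2]
    exact card_mul_le_measureReal h1 (volume_real_block h1) (hCc n).measure_lt_top.ne (hZi n)
  have hle_o : ∀ᶠ n in atTop,
      volume.real (C n) / (k n * ∏ ℓ, (t n ℓ : ℝ)) ≤ ((Zo n).card : ℝ) / k n := by
    filter_upwards [htpos, hT, hkpos, hZo'] with n h1 h2 h3 h4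
    rw [← div_div, div_right_comm]
    refine div_le_div_of_nonneg_right ?_ h3.le
    rw [div_le_iff₀ h2]
    exact measureReal_le_card_mul h1 (volume_real_block h1) (volume_block_ne_top _) h4
  -- The normalised volume lies between the inner and outer counts, which differ by `o(k)`.
  have hi : Tendsto (fun n => ((Zi n).card : ℝ) / k n) atTop (𝓝 1) := by
    refine tendsto_of_tendsto_of_tendsto_of_le_of_le' (by simpa using hvol.sub hbd) hvol ?_ hi_le
    filter_upwards [hle_o] with n hn
    rw [sub_div]
    linarith
  have ho : Tendsto (fun n => ((Zo n).card : ℝ) / k n) atTop (𝓝 1) := by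
    have := hi.add hbd
    simp only [add_zero] at this
    exact this.congr fun n => by ring
  have hDcard : ∀ n, ((D n).ncard : ℝ) = (latticeMeasure d).real (C n) := fun n => by
    rw [latticeMeasure_real (hCc n).measurableSet, hD.eq_latticePoints n]
  -- The lattice point count is squeezed between the same two box counts, so it is never compared
  -- with the volume directly.
  refine ⟨Zi, Zo, hZio, hZi, fun n z hz => (hZo n z hz).2, hZo', hi, ho,
    tendsto_of_tendsto_of_tendsto_of_le_of_le' hi ho ?_ ?_⟩
  · filter_upwards [htpos, hT, hkpos, hZo'] with n h1 h2 h3 h4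
    rw [hDcard, ← div_div, div_right_comm]
    refine div_le_div_of_nonneg_right ?_ h3.le
    rw [le_div_iff₀ h2]
    refine card_mul_le_measureReal h1 (latticeMeasure_real_block h1) ?_ (hZi n)
    have hsub : C n ⊆ ⋃ z ∈ Zo n, block (t n) z := fun u hu => by
      obtain ⟨z, hz⟩ := exists_mem_block h1 u
      exact mem_biUnion (h4 z ⟨u, hz, hu⟩) hz
    exact ne_top_of_le_ne_top (measure_biUnion_lt_top (Zo n).finite_toSet
      fun z _ => (latticeMeasure_block_ne_top _ z).lt_top).ne (measure_mono hsub)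
  · filter_upwards [htpos, hT, hkpos, hZo'] with n h1 h2 h3 h4
    rw [hDcard, ← div_div, div_right_comm]
    refine div_le_div_of_nonneg_right ?_ h3.le
    rw [div_le_iff₀ h2]
    exact measureReal_le_card_mul h1 (latticeMeasure_real_block h1)
      (latticeMeasure_block_ne_top _) h4

end BlockAsymptotics

/-- The margin left between neighbouring blocks is negligible relative to their sides. -/
theorem tendsto_margin_div {γ y : ℕ → ℝ} {t : ℕ → ℤ} (hy : Tendsto y atTop atTop)
    (hγ0 : ∀ n, 0 < γ n) (hγ : Tendsto (fun n => γ n / y n) atTop (𝓝 0))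
    (hty : Tendsto (fun n => (t n : ℝ) / y n) atTop (𝓝 1)) (r : ℕ) :
    Tendsto (fun n => ((⌈γ n⌉ + r : ℤ) : ℝ) / t n) atTop (𝓝 0) := by
  have h1 : Tendsto (fun n => ((⌈γ n⌉ + r : ℤ) : ℝ) / y n) atTop (𝓝 0) := by
    have h2 : Tendsto (fun n => γ n / y n + (1 + r) / y n) atTop (𝓝 0) := by
      simpa using hγ.add (hy.const_div_atTop (1 + r : ℝ))
    refine squeeze_zero' ?_ ?_ h2
    · filter_upwards [hy.eventually_gt_atTop 0] with n hn
      have : (0 : ℝ) ≤ ((⌈γ n⌉ + r : ℤ) : ℝ) := by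
        have := (Int.ceil_pos.2 (hγ0 n)).le
        exact_mod_cast add_nonneg this (Int.natCast_nonneg r)
      positivity
    · filter_upwards [hy.eventually_gt_atTop 0] with n hn
      rw [← add_div]
      refine div_le_div_of_nonneg_right ?_ hn.le
      push_cast
      linarith [Int.ceil_lt_add_one (γ n)]
  have h3 := h1.div hty one_ne_zero
  rw [zero_div] at h3
  refine h3.congr' ?_
  filter_upwards [hy.eventually_gt_atTop 0] with n hn
  simp only [Pi.div_apply]
  rw [div_div_div_cancel_right₀ hn.ne']

end SpatialExtremes

/-! ### Assembly of the block bounds into the limit theorem. -/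

open SpatialExtremes in
theorem corollary3p6 {d : ℕ} (hd : 1 ≤ d)
    {Ω : Type*} [MeasurableSpace Ω] (μ : Measure Ω) [IsProbabilityMeasure μ]
    -- the index sets, with their convex bodies and scaling vectors
    (D : ℕ → Set (Fin d → ℤ)) {p : ℕ} (Cpart : ℕ → Fin p → Set (Fin d → ℝ))
    (C : ℕ → Set (Fin d → ℝ)) (c : ℕ → Fin d → ℝ)
    (hD : SpatialExtremes.GeometricAssumption D Cpart C c)
    -- the stationary field
    (ξ : (Fin d → ℤ) → Ω → ℝ) (hmeas : ∀ v, Measurable (ξ v))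
    (hstat : SpatialExtremes.IsStationary μ ξ)
    -- the translation invariant total order
    (prec : (Fin d → ℤ) → (Fin d → ℤ) → Prop)
    (hprec : SpatialExtremes.IsTranslationInvariantOrder prec)
    -- the thresholds, the block numbers, and the surrounding boxes `K_n = ℤ^d ∩ c_n [-b, b]^d`
    (x : ℕ → ℝ) (k : ℕ → ℕ) (b : ℝ) (hb : 0 < b)
    (hK : ∀ n, SpatialExtremes.outerApprox (C n) (SpatialExtremes.blockSide (c n) (k n)) ⊆
      SpatialExtremes.surroundingBox (c n) b)
    -- the mixing condition
    (γ : ℕ → Fin d → ℝ) (α : ℕ → ℝ)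
    (hmix : SpatialExtremes.MixingCondition μ ξ x
      (fun n => SpatialExtremes.surroundingBox (c n) b) c γ α)
    -- the growth of `k_n`
    (hk : Tendsto k atTop atTop)
    (hkα : Tendsto (fun n => (k n : ℝ) * α n) atTop (𝓝 0))
    (hkγ : ∀ ℓ, Tendsto (fun n => (k n : ℝ) ^ ((1 : ℝ) / d) * γ n ℓ / c n ℓ) atTop (𝓝 0))
    -- the anti-clustering condition and the limit `θ`
    (m : ℕ) (hanti : SpatialExtremes.AntiClustering μ ξ D c prec m x k)
    (θ : ℝ) (hθ0 : 0 < θ) (hθ1 : θ ≤ 1)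
    (hθ : Tendsto (fun n => (μ[|{ω | x n < ξ 0 ω}]).real
      {ω | SpatialExtremes.fieldMax ξ
        (SpatialExtremes.positiveNeighbors prec (fun _ => (m : ℤ))) ω ≤ x n}) atTop (𝓝 θ)) :
    ∀ τ : ℝ, 0 ≤ τ →
      (Tendsto (fun n => ((D n).ncard : ℝ) * μ.real {ω | x n < ξ 0 ω}) atTop (𝓝 τ) ↔
        Tendsto (fun n => μ.real {ω | SpatialExtremes.fieldMax ξ (D n) ω ≤ x n}) atTop
          (𝓝 (Real.exp (-(θ * τ))))) := by
  intro τ _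
  set y : ℕ → Fin d → ℝ := fun n ℓ => c n ℓ / (k n : ℝ) ^ ((1 : ℝ) / d) with hy_def
  set t : ℕ → Fin d → ℤ := fun n => blockSide (c n) (k n) with ht_def
  set P : ℕ → ℝ := fun n => μ.real {ω | x n < ξ 0 ω} with hP_def
  set Q : ℕ → ℝ := fun n => μ.real {ω | fieldMax ξ (D n) ω ≤ x n} with hQ_def
  set N : ℕ → ℝ := fun n => ((D n).ncard : ℝ) with hN_def
  set S : Set (Fin d → ℤ) := positiveNeighbors prec (fun _ => (m : ℤ)) with hS_def
  set θn : ℕ → ℝ := fun n => (μ[|{ω | x n < ξ 0 ω}]).real {ω | fieldMax ξ S ω ≤ x n} with hθn_def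
  set η : ℕ → ℝ := fun n => μ.real {ω | fieldMax ξ S ω ≤ x n ∧ x n < ξ 0 ω ∧
    x n < fieldMax ξ (positiveNeighbors prec (t n) \ S) ω} with hη_def
  have hη : Tendsto (fun n => N n * η n) atTop (𝓝 0) := hanti
  let s : ℕ → Fin d → ℤ := fun n ℓ => ⌈γ n ℓ⌉
  let T : ℕ → ℝ := fun n => ∏ ℓ, (t n ℓ : ℝ)
  let T₁ : ℕ → ℝ := fun n => ∏ ℓ, (t n ℓ - s n ℓ : ℝ)
  let T₂ : ℕ → ℝ := fun n => ∏ ℓ, (t n ℓ - (s n ℓ + 2 * m : ℤ) : ℝ)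
  let q : ℕ → ℝ := fun n => μ.real {ω | fieldMax ξ (subBlock (t n) (s n) 0) ω ≤ x n}
  have hkR : Tendsto (fun n => (k n : ℝ)) atTop atTop := tendsto_natCast_atTop_atTop.comp hk
  have hkpos : ∀ᶠ n in atTop, (0 : ℝ) < k n := hkR.eventually_gt_atTop 0
  -- Monotonicity of `γ` bounds it below by the positive `γ 0`, so negligible separation forces the
  -- block sides to grow.
  have hy : ∀ ℓ, Tendsto (fun n => y n ℓ) atTop atTop := fun ℓ =>
    tendsto_atTop_of_sep (hmix.sep_pos 0 ℓ) (fun n => hmix.sep_mono (Nat.zero_le n) ℓ)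
      (hkpos.mono fun n hn => Real.rpow_pos_of_pos hn _) (fun n => hD.scale_pos n ℓ) (hkγ ℓ)
  have hty : ∀ ℓ, Tendsto (fun n => (t n ℓ : ℝ) / y n ℓ) atTop (𝓝 1) := fun ℓ =>
    tendsto_intFloor_div (hy ℓ)
  have ht : ∀ᶠ n in atTop, ∀ ℓ, 0 < t n ℓ := eventually_all.2 fun ℓ => by
    filter_upwards [(hy ℓ).eventually_ge_atTop 1] with n hn
    exact Int.floor_pos.2 hn
  have hγy : ∀ ℓ, Tendsto (fun n => γ n ℓ / y n ℓ) atTop (𝓝 0) := fun ℓ =>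
    (hkγ ℓ).congr fun n => by rw [hy_def, div_div_eq_mul_div, mul_comm]
  have hmargin : ∀ (r : ℕ) (ℓ : Fin d),
      Tendsto (fun n => ((s n ℓ + r : ℤ) : ℝ) / t n ℓ) atTop (𝓝 0) := fun r ℓ =>
    tendsto_margin_div (hy ℓ) (fun n => hmix.sep_pos n ℓ) (hγy ℓ) (hty ℓ) r
  have ht' : ∀ ℓ, ∀ᶠ n in atTop, (0 : ℝ) < t n ℓ := fun ℓ => ht.mono fun n hn => by
    exact_mod_cast hn ℓ
  have hT₁ : Tendsto (fun n => T₁ n / T n) atTop (𝓝 1) :=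
    tendsto_prod_sub_div_prod ht' fun ℓ => by simpa using hmargin 0 ℓ
  have hT₂ : Tendsto (fun n => T₂ n / T n) atTop (𝓝 1) :=
    tendsto_prod_sub_div_prod ht' fun ℓ => by simpa using hmargin (2 * m) ℓ
  have hst : ∀ᶠ n in atTop, ∀ ℓ, s n ℓ + 2 * m ≤ t n ℓ := eventually_all.2 fun ℓ => by
    filter_upwards [(hmargin (2 * m) ℓ).eventually_lt_const one_pos, ht' ℓ] with n h1 h2
    rw [div_lt_one h2] at h1
    have h3 : s n ℓ + (2 * m : ℕ) < t n ℓ := by exact_mod_cast h1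
    push_cast at h3
    exact h3.le
  have hs : ∀ n ℓ, 0 ≤ s n ℓ := fun n ℓ => (Int.ceil_pos.2 (hmix.sep_pos n ℓ)).le
  have hγs : ∀ n ℓ, γ n ℓ ≤ s n ℓ := fun n ℓ => Int.le_ceil _
  have hTpos : ∀ᶠ n in atTop, 0 < T n := ht.mono fun n hn =>
    Finset.prod_pos fun ℓ _ => by exact_mod_cast hn ℓ
  obtain ⟨Zi, Zo, hio, hZi, hZo, hZo', hi, ho, hDk⟩ := exists_block_counts hd hD hk hy
  have hNpos : ∀ᶠ n in atTop, 0 < N n := by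
    filter_upwards [hDk.eventually_const_lt one_pos, hkpos, hTpos] with n h1 h2 h3
    exact (div_pos_iff_of_pos_right (mul_pos h2 h3)).1 h1
  have hKo : ∀ n, ∀ z ∈ Zo n, (subBlock (t n) (s n) z : Set (Fin d → ℤ)) ⊆
      surroundingBox (c n) b := fun n z hz => by
    refine Subset.trans ?_ (hK n)
    refine Subset.trans (Finset.coe_subset.2 (subBlock_subset (hs n) z)) ?_
    rw [coe_subBlock_zero]
    exact subset_biUnion_of_mem (u := fun z => latticePoints (block (t n) z)) (hZo n z hz)
  have hE : ∀ n, μ.real {ω | x n < ξ 0 ω ∧ fieldMax ξ S ω ≤ x n} = P n * θn n := fun n =>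
    measureReal_and_eq_mul_cond hmeas S (x n)
  -- ratios of cardinalities
  have hratio : ∀ {Z : ℕ → Finset (Fin d → ℤ)} {U : ℕ → ℝ} {l : ℝ},
      Tendsto (fun n => ((Z n).card : ℝ) / k n) atTop (𝓝 1) →
      Tendsto (fun n => U n / T n) atTop (𝓝 l) →
      Tendsto (fun n => (Z n).card * U n / N n) atTop (𝓝 l) := by
    intro Z U l hZ hU
    have h := (hZ.mul hU).div hDk one_ne_zero
    simp only [one_mul, div_one] at h
    refine h.congr' ?_
    filter_upwards [hkpos, hTpos, hNpos] with n h1 h2 h3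
    simp only [Pi.div_apply]
    change _ / (N n / (k n * T n)) = _
    field_simp
  have hα : ∀ {Z : ℕ → Finset (Fin d → ℤ)},
      Tendsto (fun n => ((Z n).card : ℝ) / k n) atTop (𝓝 1) →
      Tendsto (fun n => (Z n).card * α n) atTop (𝓝 0) := by
    intro Z hZ
    have h := hZ.mul hkα
    simp only [mul_zero] at h
    refine h.congr' ?_
    filter_upwards [hkpos] with n h1
    field_simp
  have hsub : ∀ {U V : ℕ → ℝ}, Tendsto (fun n => U n / T n) atTop (𝓝 1) →
      Tendsto (fun n => V n / T n) atTop (𝓝 1) →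
      Tendsto (fun n => (U n - V n) / T n) atTop (𝓝 0) := fun hU hV => by
    simpa [sub_div] using hU.sub hV
  have hTT : Tendsto (fun n => T n / T n) atTop (𝓝 1) :=
    tendsto_const_nhds.congr' (hTpos.mono fun n hn => (div_self hn.ne').symm)
  have hρ := hratio hi hT₁
  -- The upper bound uses the inner boxes. Its error `ε` comes from anti-clustering, whose
  -- normalisation by `N n` makes it vanish without any bound on `a`.
  refine tendsto_iff_tendsto_exp (a := fun n => N n * P n) (Q := Q) hθ0
    (r' := fun n => (Zi n).card * T₁ n / N n * θn n)
    (ε := fun n => (Zi n).card * T₁ n / N n * (N n * η n)) (δ := fun n => (Zi n).card * α n)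
    (by simpa using hρ.mul hθ) (by simpa using hρ.mul hη) (hα hi) ?_ ?_ τ
  · filter_upwards [ht, hst, hNpos] with n h1 h2 h3
    have h4 : ∀ ℓ, s n ℓ ≤ t n ℓ := fun ℓ => by linarith [h2 ℓ]
    have h5 := measureReal_fieldMax_le_pow_add hmeas hstat (fun ℓ => (hmix.sep_pos n ℓ).le)
      (hmix.mixing n) h1 (hγs n) (Z := Zi n) (D := D n) (fun z hz => hKo n z (hio n hz))
      (fun z hz => by
        rw [hD.eq_latticePoints n]
        refine Subset.trans (Finset.coe_subset.2 (subBlock_subset (hs n) z)) ?_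
        rw [coe_subBlock_zero]
        exact preimage_mono (hZi n z hz))
    have h6 := measureReal_fieldMax_subBlock_le hmeas hstat hprec (hs n) h4 (x n) S
    rw [hE n] at h6
    change q n ≤ 1 - T₁ n * (P n * θn n - η n) at h6
    refine h5.trans (add_le_add_left ?_ _)
    calc q n ^ (Zi n).card ≤ Real.exp (-(T₁ n * (P n * θn n - η n))) ^ (Zi n).card :=
          pow_le_pow_left₀ measureReal_nonneg (h6.trans (Real.one_sub_le_exp_neg _)) _
      _ = _ := by
          rw [← Real.exp_nat_mul]
          congr 1
          field_simp
  -- The lower bound uses the outer boxes. In `u` and `s` the second summand accounts for points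
  -- near the faces of a core; `w` accounts for the margins. The latter enters multiplied by `a`,
  -- which is where boundedness is needed.
  · refine exists_exp_le_of_pow_le (N := fun n => (Zo n).card) (q := q)
      (s := fun n => (Zo n).card * T₁ n / N n * θn n + (Zo n).card * (T₁ n - T₂ n) / N n)
      (δ := fun n => (Zo n).card * α n) (w := fun n => (Zo n).card * (T n - T₁ n) / N n)
      (u := fun n => T₁ n * (P n * θn n) + (T₁ n - T₂ n) * P n)
      (fun n => mul_nonneg (Nat.cast_nonneg _) measureReal_nonneg) ?_ ?_ (hα ho)
      (hratio ho (hsub hTT hT₁)) ?_ ?_ ?_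
    · rw [← tendsto_natCast_atTop_iff (R := ℝ)]
      refine (ho.pos_mul_atTop one_pos hkR).congr' ?_
      filter_upwards [hkpos] with n h1
      field_simp
    · simpa using ((hratio ho hT₁).mul hθ).add (hratio ho (hsub hT₁ hT₂))
    · filter_upwards [hNpos] with n h1
      field_simp
    · filter_upwards [hst] with n h1
      have h2 := le_measureReal_fieldMax_subBlock hmeas hstat hprec m h1 (x n)
      rwa [hE n] at h2
    · filter_upwards [ht, hst, hZo', hNpos] with n h1 h2 h3 h6
      have h4 : ∀ ℓ, s n ℓ ≤ t n ℓ := fun ℓ => by linarith [h2 ℓ]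
      have h5 := pow_le_measureReal_fieldMax_add hmeas hstat (fun ℓ => (hmix.sep_pos n ℓ).le)
        (hmix.mixing n) h1 (hs n) h4 (hγs n) (Z := Zo n) (D := D n) (hKo n) (fun v hv => by
          obtain ⟨z, hz⟩ := exists_mem_block h1 (latticeEmb v)
          rw [hD.eq_latticePoints n] at hv
          refine mem_iUnion₂.2 ⟨z, h3 z ⟨_, hz, hv⟩, ?_⟩
          rw [coe_subBlock_zero]
          exact hz)
      refine h5.trans_eq ?_
      congr 1
      change (Zo n).card * (T n - T₁ n) * P n = _
      field_simp
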